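/- Let $(R,m,\kappa)$ be a Noetherian local ring and $d \ge 2$ an integer such that either $R$ is a complete regular local ring of dimension $d$, or $R \cong V[[x_1,\ldots,x_d]]/(p^s x_1)$ for some $s \ge 1$ and some complete discrete valuation ring $V$ with maximal ideal $pV$ (such a ring is Gorenstein of dimension $d$). Let $M$ be a finitely generated $R$-module of dimension $d$. If $M$ is asymptotically Cohen–Macaulay, then $M/H^0_m(M)$ is torsion-free. Here $H^0_m(M)$ is the submodule of the elements of $M$ killed by some power of $m$. An $R$-module $N$ is torsion-free if, whenever $r \in R$ and $u \in N$ satisfy $ru = 0$, either $u = 0$ or $r \in P$ for some $P \in \operatorname{Ass}(R)$. A parameter ideal of $R$ is an $m$-primary ideal generated by $\dim R$ elements. The module $M$ is $i$-effaceable if for every sequence of parameter ideals $I_n = (x_{1n},\ldots,x_{dn}) \subseteq m^n$ (with $d = \dim R$) one has \[ \lim_{n\to\infty} \frac{\ell(H^i(x_{1n},\ldots,x_{dn};M))}{\ell(R/I_n)} = 0, \] where $H^i(x_{1n},\ldots,x_{dn};M)$ is the $i$-th Koszul cohomology module and $\ell$ denotes length. The asymptotic depth of $M$ is $k$ if $M$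 is $i$-effaceable for all $i<k$ and not $k$-effaceable, and $M$ is asymptotically Cohen–Macaulay if its asymptotic depth equals $\dim M$. -/

import Mathlib

open scoped ENNReal

universe u v w

section Koszul

variable {R : Type u} [CommRing R] {r : ℕ}

/-- Degree `i` cochains of the Koszul complex on `r` elements with coefficients in `M`: the free
module `⋀^i R^r ⊗ M`, written in the basis indexed by the `i`-element subsets of `Fin r`. -/
abbrev KoszulCochain (r : ℕ) (M : Type w) (i : ℕ) : Type w :=
  {S : Finset (Fin r) // S.card = i} → M

/-- The sign `(-1) ^ #{k ∈ S | k < j}` of `e_j ∧ e_{S \ j} = ± e_S`. -/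
def koszulSign (R : Type u) [CommRing R] {r : ℕ} (S : Finset (Fin r)) (j : Fin r) : R :=
  (-1) ^ (S.filter (· < j)).card

/-- The Koszul differential, that is exterior multiplication by `∑ j, x_j e_j`:
`(d φ)_S = ∑_{j ∈ S} (-1) ^ #{k ∈ S | k < j} x_j φ_{S \ j}`. -/
def koszulD (x : Fin r → R) (M : Type w) [AddCommGroup M] [Module R M] (i : ℕ) :
    KoszulCochain r M i →ₗ[R] KoszulCochain r M (i + 1) where
  toFun φ S := ∑ j : {j // j ∈ S.1}, (koszulSign R S.1 j.1 * x j.1) •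
    φ ⟨S.1.erase j.1, by rw [Finset.card_erase_of_mem j.2, S.2]; rfl⟩
  map_add' φ ψ := by
    ext S
    simp [smul_add, Finset.sum_add_distrib]
  map_smul' c φ := by
    ext S
    simp only [Pi.smul_apply, RingHom.id_apply, Finset.smul_sum]
    exact Finset.sum_congr rfl fun j _ => smul_comm _ _ _

/-- Degree `i` Koszul cocycles. -/
def koszulCocycles (x : Fin r → R) (M : Type w) [AddCommGroup M] [Module R M] (i : ℕ) :
    Submodule R (KoszulCochain r M i) :=
  LinearMap.ker (koszulD x M i)

/-- Degree `i` Koszul coboundaries. -/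
def koszulCoboundaries (x : Fin r → R) (M : Type w) [AddCommGroup M] [Module R M] :
    (i : ℕ) → Submodule R (KoszulCochain r M i)
  | 0 => ⊥
  | i + 1 => LinearMap.range (koszulD x M i)

/-- The `i`-th Koszul cohomology module `H^i(x_1, …, x_r; M)`. -/
abbrev KoszulCohomology (x : Fin r → R) (M : Type w) [AddCommGroup M] [Module R M] (i : ℕ) :
    Type w :=
  koszulCocycles x M i ⧸ (koszulCoboundaries x M i).submoduleOf (koszulCocycles x M i)

theorem koszulSign_swap (S : Finset (Fin r)) {j k : Fin r} (hj : j ∈ S) (hjk : j < k) :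
    koszulSign R S j * koszulSign R (S.erase j) k +
      koszulSign R S k * koszulSign R (S.erase k) j = 0 := by
  have h1 : (S.erase k).filter (· < j) = S.filter (· < j) := by
    ext a; simp only [Finset.mem_filter, Finset.mem_erase]
    constructor
    · rintro ⟨⟨_, h⟩, h'⟩; exact ⟨h, h'⟩
    · rintro ⟨h, h'⟩; exact ⟨⟨(h'.trans hjk).ne, h⟩, h'⟩
  have h2 : (S.erase j).filter (· < k) = (S.filter (· < k)).erase j := by
    rw [Finset.filter_erase]
  have h3 : ((S.filter (· < k)).erase j).card + 1 = (S.filter (· < k)).card :=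
    Finset.card_erase_add_one (by simp [hj, hjk])
  unfold koszulSign
  rw [h1, h2, ← h3, pow_succ]
  ring

/-- The Koszul differential squares to zero. -/
theorem koszulD_comp_koszulD (x : Fin r → R) (M : Type w) [AddCommGroup M] [Module R M] (i : ℕ) :
    koszulD x M (i + 1) ∘ₗ koszulD x M i = 0 := by
  refine LinearMap.ext fun φ => funext fun S => ?_
  change (∑ j : {j // j ∈ S.1}, (koszulSign R S.1 j.1 * x j.1) •
    ∑ k : {k // k ∈ S.1.erase j.1}, (koszulSign R (S.1.erase j.1) k.1 * x k.1) •
      φ ⟨(S.1.erase j.1).erase k.1, _⟩) = 0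
  simp only [Finset.smul_sum, smul_smul]
  rw [Finset.sum_sigma']
  refine Finset.sum_involution
    (fun a _ => ⟨⟨a.2.1, Finset.mem_of_mem_erase a.2.2⟩,
      ⟨a.1.1, Finset.mem_erase.2 ⟨(Finset.ne_of_mem_erase a.2.2).symm, a.1.2⟩⟩⟩) ?_ ?_ ?_ ?_
  · rintro ⟨⟨j, hj⟩, ⟨k, hk⟩⟩ -
    have hk' := Finset.mem_of_mem_erase hk
    have hne := Finset.ne_of_mem_erase hk
    have hφ : ∀ h h', φ ⟨(S.1.erase k).erase j, h⟩ = φ ⟨(S.1.erase j).erase k, h'⟩ :=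
      fun h h' => congrArg φ (Subtype.ext Finset.erase_right_comm)
    dsimp only
    rw [hφ _ (by rw [Finset.card_erase_of_mem hk, Finset.card_erase_of_mem hj, S.2]; rfl),
      ← add_smul]
    have key : koszulSign R S.1 j * koszulSign R (S.1.erase j) k +
        koszulSign R S.1 k * koszulSign R (S.1.erase k) j = 0 := by
      rcases lt_or_gt_of_ne hne with h | h
      · rw [add_comm]; exact koszulSign_swap S.1 hk' h
      · exact koszulSign_swap S.1 hj h
    have : koszulSign R S.1 j * x j * (koszulSign R (S.1.erase j) k * x k) +
        koszulSign R S.1 k * x k * (koszulSign R (S.1.erase k) j * x j) =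
        (koszulSign R S.1 j * koszulSign R (S.1.erase j) k +
          koszulSign R S.1 k * koszulSign R (S.1.erase k) j) * (x j * x k) := by ring
    rw [this, key, zero_mul, zero_smul]
  · rintro ⟨⟨j, hj⟩, ⟨k, hk⟩⟩ - - h
    exact Finset.ne_of_mem_erase hk (congrArg (fun a => a.1.1) h)
  · intro a _; exact Finset.mem_univ _
  · intro a _; rfl

/-- Coboundaries are cocycles. -/
theorem koszulCoboundaries_le_koszulCocycles (x : Fin r → R) (M : Type w) [AddCommGroup M]
    [Module R M] (i : ℕ) : koszulCoboundaries x M i ≤ koszulCocycles x M i := by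
  cases i with
  | zero => exact bot_le
  | succ i =>
    rintro _ ⟨φ, rfl⟩
    exact LinearMap.congr_fun (koszulD_comp_koszulD x M i) φ

end Koszul

section AsymptoticDepth

variable (R : Type u) [CommRing R] [IsLocalRing R]

/-- `x_1, …, x_d` is a system of parameters of the local ring `R`: `d = dim R` and the ideal that
they generate is primary to the maximal ideal. Such an ideal is called a parameter ideal. -/
def IsSystemOfParameters {d : ℕ} (x : Fin d → R) : Prop :=
  ringKrullDim R = d ∧ (Ideal.span (Set.range x)).radical = IsLocalRing.maximalIdeal R

variable (M : Type w) [AddCommGroup M] [Module R M]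

/-- `M` is `i`-effaceable: for all sequences of parameter ideals `I_n = (x_{1n}, …, x_{dn}) ⊆ m^n`,
the ratio `ℓ(H^i(x_{1n}, …, x_{dn}; M)) / ℓ(R / I_n)` tends to `0`. -/
def IsEffaceable (i : ℕ) : Prop :=
  ∀ (d : ℕ) (x : ℕ → Fin d → R),
    (∀ n, IsSystemOfParameters R (x n)) →
    (∀ n, Ideal.span (Set.range (x n)) ≤ IsLocalRing.maximalIdeal R ^ n) →
    Filter.Tendsto
      (fun n => ((Module.length R (KoszulCohomology (x n) M i) : ℕ∞) : ℝ≥0∞) /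
        ((Module.length R (R ⧸ Ideal.span (Set.range (x n))) : ℕ∞) : ℝ≥0∞))
      Filter.atTop (nhds 0)

/-- The asymptotic depth of `M`: the least `k` such that `M` is not `k`-effaceable (and `⊤` if there
is none). -/
noncomputable def asyDepth : ℕ∞ :=
  ⨅ (k : ℕ) (_ : ¬ IsEffaceable R M k), (k : ℕ∞)

/-- `asydepth M = k` if and only if `M` is `i`-effaceable for all `i < k` but not `k`-effaceable. -/
theorem asyDepth_eq_coe_iff (k : ℕ) :
    asyDepth R M = k ↔ (∀ i < k, IsEffaceable R M i) ∧ ¬ IsEffaceable R M k := by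
  constructor
  · intro h
    have h1 : ∀ i < k, IsEffaceable R M i := by
      intro i hi
      by_contra hne
      have : asyDepth R M ≤ i := iInf₂_le i hne
      rw [h] at this
      exact absurd (Nat.cast_le.1 this) (not_le.2 hi)
    refine ⟨h1, fun hk => ?_⟩
    have : ((k + 1 : ℕ) : ℕ∞) ≤ asyDepth R M := by
      refine le_iInf₂ fun j hj => Nat.cast_le.2 ?_
      by_contra hlt
      rcases Nat.lt_or_ge j k with h' | h'
      · exact hj (h1 j h')
      · exact hj ((show j = k by omega) ▸ hk)
    rw [h] at this
    exact absurd (Nat.cast_le.1 this) (by omega)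
  · rintro ⟨h1, h2⟩
    refine le_antisymm (iInf₂_le k h2) (le_iInf₂ fun j hj => Nat.cast_le.2 ?_)
    by_contra hlt
    exact hj (h1 j (not_le.1 hlt))

/-- `M` is asymptotically Cohen–Macaulay: `asydepth M = dim M`. -/
def IsAsymptoticallyCM : Prop :=
  ((asyDepth R M : ℕ∞) : WithBot ℕ∞) = Module.supportDim R M

end AsymptoticDepth

section TorsionFree

variable (R : Type u) [CommRing R]

/-- `H^0_I(M)`: the submodule of the elements of `M` that are killed by some power of `I`. -/
def zerothLocalCohomology (I : Ideal R) (M : Type w) [AddCommGroup M] [Module R M] :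
    Submodule R M where
  carrier := {m | ∃ n : ℕ, ∀ a ∈ I ^ n, a • m = 0}
  zero_mem' := ⟨0, fun _ _ => smul_zero _⟩
  add_mem' := by
    rintro m m' ⟨n, hn⟩ ⟨n', hn'⟩
    refine ⟨n + n', fun a ha => ?_⟩
    rw [smul_add, hn a (Ideal.pow_le_pow_right (Nat.le_add_right _ _) ha),
      hn' a (Ideal.pow_le_pow_right (Nat.le_add_left _ _) ha), add_zero]
  smul_mem' := by
    rintro c m ⟨n, hn⟩
    exact ⟨n, fun a ha => by rw [smul_comm, hn a ha, smul_zero]⟩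

/-- `M` is torsion-free: whenever `a • m = 0`, either `m = 0` or `a` lies in some associated prime
of the ring `R`. -/
def IsTorsionFreeModule (M : Type w) [AddCommGroup M] [Module R M] : Prop :=
  ∀ (a : R) (m : M), a • m = 0 → m = 0 ∨ ∃ P ∈ associatedPrimes R R, a ∈ P

end TorsionFree

/-- `R` is (isomorphic to) a ring `V[[x_1, …, x_d]] / (p ^ s x_1)` with `s ≥ 1`, where `V` is a
complete discrete valuation ring with maximal ideal `pV`. -/
def IsPowerSeriesModMonomial.{u', v'} (R : Type u') [CommRing R] (d : ℕ) : Prop :=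
  ∃ (V : Type v') (_ : CommRing V) (_ : IsDomain V) (_ : IsDiscreteValuationRing V)
    (_ : IsAdicComplete (IsLocalRing.maximalIdeal V) V) (p : V) (s : ℕ) (hd : 0 < d),
    IsLocalRing.maximalIdeal V = Ideal.span {p} ∧ 1 ≤ s ∧
      Nonempty (R ≃+* (MvPowerSeries (Fin d) V ⧸
        Ideal.span {(MvPowerSeries.C p ^ s * MvPowerSeries.X ⟨0, hd⟩ :
          MvPowerSeries (Fin d) V)}))

/-! The hypothesis on $R$ enters through $\dim R = d$; the rest is an argument over any Noetherian
local ring of dimension $d$. Suppose $au \in H^0_m(M)$ with $u \notin H^0_m(M)$ and $a$ outside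
every associated prime of $R$. Then $Ru$ has an associated prime $P \ne m$, it contains $a$, and it
strictly contains a minimal prime of $R$. So $P \in \operatorname{Ass}(M)$ has coheight less than
$d$, and `exists_not_isEffaceable` contradicts $i$-effaceability for all $i < d$.

To refute effaceability, take a prime $Q \supseteq P$ maximal among the nonmaximal primes. Put $e =
d-1$ and choose parameters $f_1,\dots,f_e \in Q$ and $a \notin Q$
(`exists_parameters_of_coheight_le_one`; this $a$ is a new element). The depth of $M_Q$ is at most
$\dim R_Q/PR_Q \le d-2$. Hence some class in $H^k(f_1,\dots,f_e;M)$ with $k \le d-2$ is killed by no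
power of $a$ (`exists_subsetCocycle_of_le_prime`).

With $f_0 = 0$, consider the parameters $f_{j+1}a^n + f_j^n$ for $j < e$, together with $a^N +
f_e^n$; they lie in $m^n$ when $N \ge n$. Replacing the first $e$ of them in turn by $f_1,\dots,f_e$
does not increase the length of $H^{k+1}$, and at the end this length is at least $N$
(`le_length_koszulCohomology_curveParameters`). On the other side $\ell(R/I) \le cN + e\,b_n$, with
$b_n$ independent of $N$ (`length_quotient_curveParameters_le`). Taking $N \ge e\,b_n$ keeps the
ratio above $1/(c+1)$. -/

/-! ### Koszul complexes on subfamilies, contraction and exterior multiplication -/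

section SubsetKoszul

variable {R : Type u} [CommRing R] {r : ℕ}

/-- Exterior multiplication by `∑ j, x_j e_j`, on families indexed by all subsets of `Fin r`. -/
def wedge (x : Fin r → R) (M : Type w) [AddCommGroup M] [Module R M] :
    (Finset (Fin r) → M) →ₗ[R] (Finset (Fin r) → M) where
  toFun φ S := ∑ j ∈ S, (koszulSign R S j * x j) • φ (S.erase j)
  map_add' φ ψ := by
    ext S
    simp [smul_add, Finset.sum_add_distrib]
  map_smul' c φ := by
    ext S
    simp only [Pi.smul_apply, RingHom.id_apply, Finset.smul_sum]
    exact Finset.sum_congr rfl fun j _ => smul_comm _ _ _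

variable (x : Fin r → R) (M : Type w) [AddCommGroup M] [Module R M] (T : Finset (Fin r)) (i : ℕ)

theorem wedge_apply (φ : Finset (Fin r) → M) (S : Finset (Fin r)) :
    wedge x M φ S = ∑ j ∈ S, (koszulSign R S j * x j) • φ (S.erase j) := rfl

/-- The cochains of degree `i` of the Koszul complex on the `x_j` with `j ∈ T`. -/
def subsetCochains (R : Type u) [CommRing R] (M : Type w) [AddCommGroup M] [Module R M]
    (T : Finset (Fin r)) (i : ℕ) : Submodule R (Finset (Fin r) → M) where
  carrier := {φ | ∀ S, ¬ (S ⊆ T ∧ S.card = i) → φ S = 0}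
  zero_mem' := fun _ _ => rfl
  add_mem' := fun ha hb S hS => by simp [ha S hS, hb S hS]
  smul_mem' := fun c a ha S hS => by simp [ha S hS]

/-- The cocycles of degree `i` of the Koszul complex on the `x_j` with `j ∈ T`. -/
def subsetCocycles : Submodule R (Finset (Fin r) → M) where
  carrier := {φ | φ ∈ subsetCochains R M T i ∧ ∀ S ⊆ T, wedge x M φ S = 0}
  zero_mem' := ⟨zero_mem _, fun _ _ => by simp⟩
  add_mem' := fun ha hb => ⟨add_mem ha.1 hb.1, fun S hS => by simp [ha.2 S hS, hb.2 S hS]⟩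
  smul_mem' := fun c a ha => ⟨Submodule.smul_mem _ c ha.1, fun S hS => by simp [ha.2 S hS]⟩

/-- The coboundaries of degree `i` of the Koszul complex on the `x_j` with `j ∈ T`. -/
def subsetCoboundaries : Submodule R (Finset (Fin r) → M) where
  carrier := {φ | φ ∈ subsetCochains R M T i ∧ ∃ ψ, ∀ S ⊆ T, φ S = wedge x M ψ S}
  zero_mem' := ⟨zero_mem _, 0, fun _ _ => by simp⟩
  add_mem' := by
    rintro a b ⟨ha, ψ, hψ⟩ ⟨hb, χ, hχ⟩
    exact ⟨add_mem ha hb, ψ + χ, fun S hS => by simp [hψ S hS, hχ S hS]⟩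
  smul_mem' := by
    rintro c a ⟨ha, ψ, hψ⟩
    exact ⟨Submodule.smul_mem _ c ha, c • ψ, fun S hS => by simp [hψ S hS]⟩

/-- The Koszul cohomology on the `x_j` with `j ∈ T`. -/
abbrev SubsetCohomology : Type w :=
  subsetCocycles x M T i ⧸ (subsetCoboundaries x M T i).submoduleOf (subsetCocycles x M T i)

variable {x M T i}

theorem mem_subsetCochains {φ : Finset (Fin r) → M} :
    φ ∈ subsetCochains R M T i ↔ ∀ S, ¬ (S ⊆ T ∧ S.card = i) → φ S = 0 := Iff.rfl

theorem mem_subsetCocycles {φ : Finset (Fin r) → M} : φ ∈ subsetCocycles x M T i ↔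
    φ ∈ subsetCochains R M T i ∧ ∀ S ⊆ T, wedge x M φ S = 0 := Iff.rfl

theorem mem_subsetCoboundaries {φ : Finset (Fin r) → M} : φ ∈ subsetCoboundaries x M T i ↔
    φ ∈ subsetCochains R M T i ∧ ∃ ψ, ∀ S ⊆ T, φ S = wedge x M ψ S := Iff.rfl

theorem wedge_congr {y : Fin r → R} {φ ψ : Finset (Fin r) → M} {S : Finset (Fin r)}
    (h : ∀ j ∈ S, x j = y j) (h' : ∀ U ⊆ S, φ U = ψ U) : wedge x M φ S = wedge y M ψ S :=
  Finset.sum_congr rfl fun j hj => by rw [h j hj, h' _ (Finset.erase_subset _ _)]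

theorem subsetCocycles_congr {y : Fin r → R} (h : ∀ j ∈ T, x j = y j) :
    subsetCocycles x M T i = subsetCocycles y M T i := by
  ext φ
  simp only [mem_subsetCocycles]
  refine and_congr_right fun _ => forall₂_congr fun S hS => ?_
  rw [wedge_congr (fun j hj => h j (hS hj)) fun _ _ => rfl]

theorem subsetCoboundaries_congr {y : Fin r → R} (h : ∀ j ∈ T, x j = y j) :
    subsetCoboundaries x M T i = subsetCoboundaries y M T i := by
  ext φ
  simp only [mem_subsetCoboundaries]
  refine and_congr_right fun _ => exists_congr fun ψ => forall₂_congr fun S hS => ?_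
  rw [wedge_congr (fun j hj => h j (hS hj)) fun _ _ => rfl]

theorem koszulSign_mul_self (S : Finset (Fin r)) (j : Fin r) :
    koszulSign R S j * koszulSign R S j = 1 := by
  unfold koszulSign
  rw [← mul_pow]; simp

theorem koszulSign_insert_self (S : Finset (Fin r)) (j : Fin r) :
    koszulSign R (insert j S) j = koszulSign R S j := by
  unfold koszulSign
  rw [Finset.filter_insert, if_neg (lt_irrefl j)]

/-- Exactly one of the two signs changes: that of `l` if `j < l`, that of `j` if `l < j`. -/
theorem koszulSign_insert_mul_erase {S : Finset (Fin r)} {j l : Fin r} (hj : j ∉ S) (hl : l ∈ S) :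
    koszulSign R (insert j S) l * koszulSign R (S.erase l) j =
      -(koszulSign R S j * koszulSign R S l) := by
  have hne : j ≠ l := fun h => hj (h ▸ hl)
  unfold koszulSign
  rw [Finset.filter_insert, Finset.filter_erase]
  rcases lt_or_gt_of_ne hne with h | h
  · rw [if_pos h, Finset.card_insert_of_notMem (by simp [hj]),
      Finset.erase_eq_of_notMem (by simp [h.le])]
    ring
  · have h3 := Finset.card_erase_add_one (s := S.filter (· < j)) (a := l) (by simp [hl, h])
    rw [if_neg h.le.not_gt, ← h3]
    ring

/-- Contraction with the dual basis vector of `e_j`. -/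
def contract (R : Type u) [CommRing R] (M : Type w) [AddCommGroup M] [Module R M] (j : Fin r) :
    (Finset (Fin r) → M) →ₗ[R] (Finset (Fin r) → M) where
  toFun φ S := if j ∈ S then 0 else koszulSign R S j • φ (insert j S)
  map_add' φ ψ := by
    ext S
    by_cases h : j ∈ S <;> simp [h]
  map_smul' c φ := by
    ext S
    by_cases h : j ∈ S <;> simp [h, smul_comm c]

theorem contract_apply {j : Fin r} {S : Finset (Fin r)} (h : j ∉ S) (φ : Finset (Fin r) → M) :
    contract R M j φ S = koszulSign R S j • φ (insert j S) := if_neg h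

theorem contract_apply_of_mem {j : Fin r} {S : Finset (Fin r)} (h : j ∈ S)
    (φ : Finset (Fin r) → M) : contract R M j φ S = 0 := if_pos h

/-- Exterior multiplication by `e_j`. -/
def basisWedge (R : Type u) [CommRing R] (M : Type w) [AddCommGroup M] [Module R M] (j : Fin r) :
    (Finset (Fin r) → M) →ₗ[R] (Finset (Fin r) → M) where
  toFun φ S := if j ∈ S then koszulSign R S j • φ (S.erase j) else 0
  map_add' φ ψ := by
    ext S
    by_cases h : j ∈ S <;> simp [h]
  map_smul' c φ := by
    ext S
    by_cases h : j ∈ S <;> simp [h, smul_comm c]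

theorem basisWedge_apply {j : Fin r} {S : Finset (Fin r)} (h : j ∈ S) (φ : Finset (Fin r) → M) :
    basisWedge R M j φ S = koszulSign R S j • φ (S.erase j) := if_pos h

theorem basisWedge_apply_of_notMem {j : Fin r} {S : Finset (Fin r)} (h : j ∉ S)
    (φ : Finset (Fin r) → M) : basisWedge R M j φ S = 0 := if_neg h

/-- Restriction to the subsets that do not contain `j`. -/
def dropIndex (R : Type u) [CommRing R] (M : Type w) [AddCommGroup M] [Module R M] (j : Fin r) :
    (Finset (Fin r) → M) →ₗ[R] (Finset (Fin r) → M) where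
  toFun φ S := if j ∈ S then 0 else φ S
  map_add' φ ψ := by
    ext S
    by_cases h : j ∈ S <;> simp [h]
  map_smul' c φ := by
    ext S
    by_cases h : j ∈ S <;> simp [h]

theorem dropIndex_apply {j : Fin r} {S : Finset (Fin r)} (h : j ∉ S) (φ : Finset (Fin r) → M) :
    dropIndex R M j φ S = φ S := if_neg h

theorem dropIndex_apply_of_mem {j : Fin r} {S : Finset (Fin r)} (h : j ∈ S)
    (φ : Finset (Fin r) → M) : dropIndex R M j φ S = 0 := if_pos h

/-- Cartan's formula for contraction and exterior multiplication. -/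
theorem contract_wedge {j : Fin r} {S : Finset (Fin r)} (hj : j ∉ S) (φ : Finset (Fin r) → M) :
    koszulSign R S j • wedge x M φ (insert j S) =
      x j • φ S - wedge x M (contract R M j φ) S := by
  rw [wedge_apply, Finset.sum_insert hj, Finset.erase_insert hj, smul_add, koszulSign_insert_self,
    smul_smul, ← mul_assoc, koszulSign_mul_self, one_mul, wedge_apply, sub_eq_add_neg,
    ← Finset.sum_neg_distrib, Finset.smul_sum]
  congr 1
  refine Finset.sum_congr rfl fun l hl => ?_
  have hne : l ≠ j := fun h => hj (h ▸ hl)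
  rw [contract_apply (fun h => hj (Finset.mem_of_mem_erase h)),
    Finset.erase_insert_of_ne hne.symm, smul_smul, smul_smul, ← neg_smul]
  congr 1
  have h := koszulSign_insert_mul_erase (R := R) hj hl
  have h1 := koszulSign_mul_self (R := R) (S.erase l) j
  -- A square of a sign is inserted so that the anticommutation relation `h` applies.
  calc _ = koszulSign R S j * x l * (koszulSign R (insert j S) l *
          (koszulSign R (S.erase l) j * koszulSign R (S.erase l) j)) := by rw [h1]; ring
    _ = koszulSign R S j * x l * koszulSign R (S.erase l) j *
          (koszulSign R (insert j S) l * koszulSign R (S.erase l) j) := by ring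
    _ = -((koszulSign R S j * koszulSign R S j) * koszulSign R S l * x l *
          koszulSign R (S.erase l) j) := by rw [h]; ring
    _ = _ := by rw [koszulSign_mul_self]; ring

theorem wedge_insert {j : Fin r} {S : Finset (Fin r)} (hj : j ∉ S) (φ : Finset (Fin r) → M) :
    wedge x M φ (insert j S) =
      koszulSign R S j • (x j • φ S - wedge x M (contract R M j φ) S) := by
  rw [← contract_wedge hj, smul_smul, koszulSign_mul_self, one_smul]

/-- Contraction is a left inverse of exterior multiplication by `e_j`, off the subsets containing
`j`. -/
theorem contract_basisWedge {j : Fin r} {S : Finset (Fin r)} (hj : j ∉ S)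
    (φ : Finset (Fin r) → M) : contract R M j (basisWedge R M j φ) S = φ S := by
  rw [contract_apply hj, basisWedge_apply (Finset.mem_insert_self _ _), Finset.erase_insert hj,
    koszulSign_insert_self, smul_smul, koszulSign_mul_self, one_smul]

theorem wedge_basisWedge_of_notMem {j : Fin r} {S : Finset (Fin r)} (hj : j ∉ S)
    (φ : Finset (Fin r) → M) : wedge x M (basisWedge R M j φ) S = 0 :=
  Finset.sum_eq_zero fun l hl => by
    rw [basisWedge_apply_of_notMem (fun h => hj (Finset.mem_of_mem_erase h)), smul_zero]

theorem wedge_basisWedge {j : Fin r} {S : Finset (Fin r)} (hj : j ∉ S)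
    (φ : Finset (Fin r) → M) :
    wedge x M (basisWedge R M j φ) (insert j S) = -(koszulSign R S j • wedge x M φ S) := by
  rw [wedge_insert hj, basisWedge_apply_of_notMem hj, smul_zero, zero_sub, smul_neg,
    wedge_congr (fun _ _ => rfl) fun U hU => contract_basisWedge (fun h => hj (hU h)) φ]

end SubsetKoszul

/-- Exactness at `H` gives a short exact sequence with ends `X ⧸ ker f` and `range g`. -/
theorem Module.length_eq_quotient_ker_add_range {R X H Y : Type*} [Ring R] [AddCommGroup X]
    [AddCommGroup H] [AddCommGroup Y] [Module R X] [Module R H] [Module R Y] (f : X →ₗ[R] H)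
    (g : H →ₗ[R] Y) (h : Function.Exact f g) :
    Module.length R H = Module.length R (X ⧸ LinearMap.ker f) + Module.length R (LinearMap.range g) := by
  rw [f.quotKerEquivRange.length_eq]
  refine Module.length_eq_add_of_exact (LinearMap.range f).subtype g.rangeRestrict
    (Submodule.injective_subtype _) g.surjective_rangeRestrict fun y => ?_
  rw [Submodule.coe_subtype, Subtype.range_coe, ← LinearMap.mem_ker, LinearMap.ker_rangeRestrict,
    LinearMap.mem_ker, h y]
  rfl

/-- The map of subquotients induced by a linear map. -/
def Submodule.subquotientMap {R C C' : Type*} [CommRing R] [AddCommGroup C] [AddCommGroup C']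
    [Module R C] [Module R C'] {Z B : Submodule R C} {Z' B' : Submodule R C'} (g : C →ₗ[R] C')
    (hZ : ∀ z ∈ Z, g z ∈ Z') (hB : ∀ b ∈ B, g b ∈ B') :
    (Z ⧸ B.submoduleOf Z) →ₗ[R] (Z' ⧸ B'.submoduleOf Z') :=
  Submodule.mapQ _ _ (g.restrict hZ) fun _ hb => hB _ hb

theorem Submodule.mk_submoduleOf_eq_zero {R C : Type*} [CommRing R] [AddCommGroup C]
    [Module R C] {Z B : Submodule R C} (z : Z) :
    (Submodule.Quotient.mk z : Z ⧸ B.submoduleOf Z) = 0 ↔ (z : C) ∈ B :=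
  Submodule.Quotient.mk_eq_zero _

/-! ### Adjoining one element: the long exact sequence and lengths -/

section SubsetKoszul

variable {R : Type u} [CommRing R] {r : ℕ} {x : Fin r → R} {M : Type w} [AddCommGroup M]
  [Module R M] {T : Finset (Fin r)} {i : ℕ} {j : Fin r}

/-- By Cartan's formula, contraction with `e_j` is a homotopy from multiplication by `x j` to zero.
-/
theorem smul_mem_subsetCoboundaries (hj : j ∈ T) {φ : Finset (Fin r) → M}
    (hφ : φ ∈ subsetCocycles x M T i) : x j • φ ∈ subsetCoboundaries x M T i := by
  refine ⟨Submodule.smul_mem _ _ hφ.1, contract R M j φ, fun S hS => ?_⟩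
  rw [Pi.smul_apply]
  by_cases h : j ∈ S
  · have h2 := wedge_insert (x := x) (Finset.notMem_erase j S) (contract R M j φ)
    rw [Finset.insert_erase h] at h2
    rw [h2, contract_apply (Finset.notMem_erase j S), Finset.insert_erase h,
      wedge_congr (y := x) (ψ := 0) (fun _ _ => rfl) fun U hU => ?_, map_zero, Pi.zero_apply, sub_zero,
      smul_smul, smul_smul, mul_right_comm, koszulSign_mul_self, one_mul]
    have hU' : j ∉ U := fun h' => Finset.notMem_erase j S (hU h')
    rw [contract_apply hU', contract_apply_of_mem (Finset.mem_insert_self _ _), smul_zero]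
    rfl
  · have := contract_wedge (x := x) h φ
    rw [hφ.2 _ (Finset.insert_subset hj hS), smul_zero] at this
    exact sub_eq_zero.1 this.symm

theorem smul_subsetCohomology_eq_zero {c : R} (hc : c ∈ Ideal.span (x '' T))
    (z : SubsetCohomology x M T i) : c • z = 0 := by
  suffices h : Ideal.span (x '' T) ≤ Module.annihilator R (SubsetCohomology x M T i) from
    Module.mem_annihilator.1 (h hc) z
  rw [Ideal.span_le]
  rintro _ ⟨j, hj, rfl⟩
  refine Module.mem_annihilator.2 fun z => ?_
  obtain ⟨φ, rfl⟩ := Submodule.Quotient.mk_surjective _ z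
  rw [← Submodule.Quotient.mk_smul, Submodule.mk_submoduleOf_eq_zero]
  exact smul_mem_subsetCoboundaries hj φ.2

/-- Coboundaries allow an arbitrary primitive. Since `wedge` raises degree by one, truncating the
primitive to degree `i` and to subsets of `T` changes nothing. -/
theorem exists_subsetCochain_of_eq_wedge {φ ψ : Finset (Fin r) → M}
    (hφ : φ ∈ subsetCochains R M T (i + 1)) (h : ∀ S ⊆ T, φ S = wedge x M ψ S) :
    ∃ χ ∈ subsetCochains R M T i, ∀ S ⊆ T, φ S = wedge x M χ S := by
  classical
  refine ⟨fun S => if S ⊆ T ∧ S.card = i then ψ S else 0, fun S hS => if_neg hS, fun S hS => ?_⟩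
  by_cases hc : S.card = i + 1
  · rw [h S hS]
    refine Finset.sum_congr rfl fun l hl => ?_
    dsimp only
    rw [if_pos ⟨(Finset.erase_subset _ _).trans hS, by rw [Finset.card_erase_of_mem hl, hc]; rfl⟩]
  · rw [hφ S fun h => hc h.2]
    refine (Finset.sum_eq_zero fun l hl => ?_).symm
    dsimp only
    rw [if_neg fun h => hc ?_, smul_zero]
    rw [← h.2, Finset.card_erase_add_one hl]

theorem basisWedge_mem_subsetCochains {φ : Finset (Fin r) → M}
    (hφ : φ ∈ subsetCochains R M T i) :
    basisWedge R M j φ ∈ subsetCochains R M (insert j T) (i + 1) := by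
  intro S hS
  by_cases h : j ∈ S
  · rw [basisWedge_apply h, hφ _ fun h' => hS ⟨?_, ?_⟩, smul_zero]
    · rw [← Finset.insert_erase h]
      exact Finset.insert_subset_insert _ h'.1
    · rw [← h'.2, Finset.card_erase_add_one h]
  · exact basisWedge_apply_of_notMem h φ

theorem contract_mem_subsetCochains {φ : Finset (Fin r) → M}
    (hφ : φ ∈ subsetCochains R M (insert j T) (i + 1)) :
    contract R M j φ ∈ subsetCochains R M T i := by
  intro S hS
  by_cases h : j ∈ S
  · exact contract_apply_of_mem h φ
  · rw [contract_apply h, hφ _ fun h' => hS ⟨?_, ?_⟩, smul_zero]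
    · exact (Finset.insert_subset_insert_iff h).1 h'.1
    · simpa [Finset.card_insert_of_notMem h] using h'.2

theorem dropIndex_mem_subsetCochains {φ : Finset (Fin r) → M}
    (hφ : φ ∈ subsetCochains R M (insert j T) i) : dropIndex R M j φ ∈ subsetCochains R M T i := by
  intro S hS
  by_cases h : j ∈ S
  · exact dropIndex_apply_of_mem h φ
  · rw [dropIndex_apply h, hφ _ fun h' => hS ⟨(Finset.subset_insert_iff_of_notMem h).1 h'.1, h'.2⟩]

theorem subsetCochains_mono {T' : Finset (Fin r)} (h : T ⊆ T') :
    subsetCochains R M T i ≤ subsetCochains R M T' i :=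
  fun _ hφ S hS => hφ S fun h' => hS ⟨h'.1.trans h, h'.2⟩

theorem wedge_insert_of_mem_subsetCochains (hj : j ∉ T) {φ : Finset (Fin r) → M}
    (hφ : φ ∈ subsetCochains R M T i) {S : Finset (Fin r)} (hS : j ∉ S) :
    wedge x M φ (insert j S) = koszulSign R S j • x j • φ S := by
  rw [wedge_insert hS, wedge_congr (y := x) (ψ := 0) (fun _ _ => rfl) fun U hU => ?_, map_zero,
    Pi.zero_apply, sub_zero]
  rw [contract_apply fun h => hS (hU h), hφ _ fun h => hj (h.1 (Finset.mem_insert_self _ _)),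
    smul_zero]
  rfl

theorem forall_subset_insert_iff {p : Finset (Fin r) → Prop} :
    (∀ S ⊆ insert j T, p S) ↔ ∀ S ⊆ T, p S ∧ p (insert j S) := by
  refine ⟨fun h S hS => ⟨h S (hS.trans (Finset.subset_insert _ _)),
    h _ (Finset.insert_subset_insert _ hS)⟩, fun h S hS => ?_⟩
  by_cases hS' : j ∈ S
  · rw [← Finset.insert_erase hS']
    exact (h _ (Finset.subset_insert_iff.1 hS)).2
  · exact (h _ ((Finset.subset_insert_iff_of_notMem hS').1 hS)).1

theorem basisWedge_mem_subsetCocycles (hj : j ∉ T) {φ : Finset (Fin r) → M}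
    (hφ : φ ∈ subsetCocycles x M T i) :
    basisWedge R M j φ ∈ subsetCocycles x M (insert j T) (i + 1) := by
  refine ⟨basisWedge_mem_subsetCochains hφ.1, forall_subset_insert_iff.2 fun S hS => ?_⟩
  rw [wedge_basisWedge_of_notMem (fun h => hj (hS h)), wedge_basisWedge (fun h => hj (hS h)),
    hφ.2 S hS]
  simp

theorem basisWedge_mem_subsetCoboundaries (hj : j ∉ T) {φ : Finset (Fin r) → M}
    (hφ : φ ∈ subsetCoboundaries x M T i) :
    basisWedge R M j φ ∈ subsetCoboundaries x M (insert j T) (i + 1) := by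
  obtain ⟨h1, ψ, hψ⟩ := hφ
  refine ⟨basisWedge_mem_subsetCochains h1, basisWedge R M j (-ψ),
    forall_subset_insert_iff.2 fun S hS => ?_⟩
  have h : j ∉ S := fun h => hj (hS h)
  rw [wedge_basisWedge_of_notMem h, wedge_basisWedge h, basisWedge_apply_of_notMem h,
    basisWedge_apply (Finset.mem_insert_self _ _), Finset.erase_insert h, hψ S hS,
    koszulSign_insert_self]
  simp

theorem dropIndex_mem_subsetCocycles (hj : j ∉ T) {φ : Finset (Fin r) → M}
    (hφ : φ ∈ subsetCocycles x M (insert j T) i) :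
    dropIndex R M j φ ∈ subsetCocycles x M T i := by
  refine ⟨dropIndex_mem_subsetCochains hφ.1, fun S hS => ?_⟩
  rw [← hφ.2 S (hS.trans (Finset.subset_insert _ _))]
  exact wedge_congr (fun _ _ => rfl) fun U hU => dropIndex_apply (fun h => hj (hS (hU h))) φ

theorem dropIndex_mem_subsetCoboundaries (hj : j ∉ T) {φ : Finset (Fin r) → M}
    (hφ : φ ∈ subsetCoboundaries x M (insert j T) i) :
    dropIndex R M j φ ∈ subsetCoboundaries x M T i := by
  obtain ⟨h1, ψ, hψ⟩ := hφ
  refine ⟨dropIndex_mem_subsetCochains h1, ψ, fun S hS => ?_⟩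
  rw [dropIndex_apply (fun h => hj (hS h)), hψ S (hS.trans (Finset.subset_insert _ _))]

/-- The connecting map from the Koszul cohomology on `T` to that on `insert j T`. -/
def basisWedgeCohomology (x : Fin r → R) (M : Type w) [AddCommGroup M] [Module R M] (i : ℕ)
    (hj : j ∉ T) : SubsetCohomology x M T i →ₗ[R] SubsetCohomology x M (insert j T) (i + 1) :=
  Submodule.subquotientMap (basisWedge R M j) (fun _ => basisWedge_mem_subsetCocycles hj)
    fun _ => basisWedge_mem_subsetCoboundaries hj

/-- The restriction map from the Koszul cohomology on `insert j T` to that on `T`. -/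
def dropIndexCohomology (x : Fin r → R) (M : Type w) [AddCommGroup M] [Module R M] (i : ℕ)
    (hj : j ∉ T) : SubsetCohomology x M (insert j T) i →ₗ[R] SubsetCohomology x M T i :=
  Submodule.subquotientMap (dropIndex R M j) (fun _ => dropIndex_mem_subsetCocycles hj)
    fun _ => dropIndex_mem_subsetCoboundaries hj

/-- The complex on `insert j T` is a shifted mapping cone of `x j`: a cochain is `α + e_j ∧ β`, with
differential `dα + e_j ∧ (x_j α - dβ)`. -/
theorem exact_basisWedgeCohomology_dropIndexCohomology (hj : j ∉ T) :
    Function.Exact (basisWedgeCohomology x M i hj) (dropIndexCohomology x M (i + 1) hj) := by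
  intro z
  obtain ⟨φ, rfl⟩ := Submodule.Quotient.mk_surjective _ z
  obtain ⟨φ, hφ⟩ := φ
  constructor
  · intro h
    obtain ⟨h1, ψ', hψ'⟩ := (Submodule.mk_submoduleOf_eq_zero _).1 h
    obtain ⟨ψ, hψ, hψ2⟩ := exists_subsetCochain_of_eq_wedge h1 hψ'
    -- If the part of `φ` without `e_j` is `dψ` over `T`, then over `insert j T` the cocycle `φ -
    -- dψ` is `e_j` times this element.
    have hβ : contract R M j φ - x j • ψ ∈ subsetCocycles x M T i := by
      refine ⟨sub_mem (contract_mem_subsetCochains hφ.1) (Submodule.smul_mem _ _ hψ),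
        fun S hS => ?_⟩
      have h := contract_wedge (x := x) (fun h => hj (hS h)) φ
      have h2 := hψ2 S hS
      change dropIndex R M j φ S = _ at h2
      rw [dropIndex_apply (fun h => hj (hS h))] at h2
      rw [hφ.2 _ (Finset.insert_subset_insert _ hS), smul_zero, h2] at h
      rw [map_sub, map_smul, Pi.sub_apply, Pi.smul_apply, ← neg_sub, ← h, neg_zero]
    refine ⟨Submodule.Quotient.mk ⟨_, hβ⟩, ?_⟩
    refine Eq.symm ((Submodule.Quotient.eq _).2 ?_)
    change φ - basisWedge R M j (contract R M j φ - x j • ψ) ∈ subsetCoboundaries x M _ _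
    refine ⟨sub_mem hφ.1 (basisWedge_mem_subsetCochains hβ.1), ψ,
      forall_subset_insert_iff.2 fun S hS => ?_⟩
    have h : j ∉ S := fun h => hj (hS h)
    have h2 := hψ2 S hS
    change dropIndex R M j φ S = _ at h2
    rw [dropIndex_apply h] at h2
    refine ⟨?_, ?_⟩
    · rw [Pi.sub_apply, basisWedge_apply_of_notMem h, sub_zero, h2]
    · rw [wedge_insert_of_mem_subsetCochains hj hψ h, Pi.sub_apply,
        basisWedge_apply (Finset.mem_insert_self _ _), Finset.erase_insert h, Pi.sub_apply,
        contract_apply h, smul_sub, koszulSign_insert_self, smul_smul, koszulSign_mul_self,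
        one_smul, sub_sub_cancel, Pi.smul_apply]
  · rintro ⟨w, hw⟩
    obtain ⟨β, rfl⟩ := Submodule.Quotient.mk_surjective _ w
    rw [← hw]
    refine (Submodule.mk_submoduleOf_eq_zero _).2 ?_
    change dropIndex R M j (basisWedge R M j β.1) ∈ _
    suffices h : dropIndex R M j (basisWedge R M j β.1) = 0 from h ▸ zero_mem _
    ext S
    rw [Pi.zero_apply]
    by_cases h : j ∈ S
    · exact dropIndex_apply_of_mem h _
    · rw [dropIndex_apply h, basisWedge_apply_of_notMem h]

/-- Writing a primitive of `e_j ∧ β` as `α + e_j ∧ γ` gives `dα = 0` and `β = x_j α - dγ`. -/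
theorem ker_basisWedgeCohomology (hj : j ∉ T) : LinearMap.ker (basisWedgeCohomology x M i hj) =
    LinearMap.range (LinearMap.lsmul R (SubsetCohomology x M T i) (x j)) := by
  ext z
  constructor
  · intro h
    obtain ⟨β, rfl⟩ := Submodule.Quotient.mk_surjective _ z
    obtain ⟨h1, ψ', hψ'⟩ := (Submodule.mk_submoduleOf_eq_zero _).1 h
    obtain ⟨ψ, hψ, hψ2⟩ := exists_subsetCochain_of_eq_wedge h1 hψ'
    have hd : ∀ S ⊆ T, wedge x M ψ S = 0 := fun S hS => by
      rw [← (forall_subset_insert_iff.1 hψ2 S hS).1]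
      exact basisWedge_apply_of_notMem (fun h => hj (hS h)) _
    have hα : dropIndex R M j ψ ∈ subsetCocycles x M T i := by
      refine ⟨dropIndex_mem_subsetCochains hψ, fun S hS => ?_⟩
      rw [← hd S hS]
      exact wedge_congr (fun _ _ => rfl) fun U hU => dropIndex_apply (fun h => hj (hS (hU h))) _
    refine ⟨Submodule.Quotient.mk ⟨_, hα⟩, (Submodule.Quotient.eq _).2 ?_⟩
    change x j • dropIndex R M j ψ - β.1 ∈ subsetCoboundaries x M T i
    refine ⟨sub_mem (Submodule.smul_mem _ _ hα.1) β.2.1, contract R M j ψ, fun S hS => ?_⟩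
    have h : j ∉ S := fun h => hj (hS h)
    have h2 := contract_wedge (x := x) h ψ
    have h3 := (forall_subset_insert_iff.1 hψ2 S hS).2
    change basisWedge R M j β.1 _ = _ at h3
    rw [← h3, ← contract_apply h, contract_basisWedge h] at h2
    rw [Pi.sub_apply, h2, Pi.smul_apply, dropIndex_apply h, sub_sub_cancel]
  · rintro ⟨w, rfl⟩
    obtain ⟨α, rfl⟩ := Submodule.Quotient.mk_surjective _ w
    refine LinearMap.mem_ker.2 ((Submodule.mk_submoduleOf_eq_zero _).2 ?_)
    change basisWedge R M j (x j • α.1) ∈ _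
    refine ⟨basisWedge_mem_subsetCochains (Submodule.smul_mem _ _ α.2.1), α.1,
      forall_subset_insert_iff.2 fun S hS => ?_⟩
    have h : j ∉ S := fun h => hj (hS h)
    rw [α.2.2 S hS, wedge_insert_of_mem_subsetCochains hj α.2.1 h, basisWedge_apply_of_notMem h,
      basisWedge_apply (Finset.mem_insert_self _ _), Finset.erase_insert h, koszulSign_insert_self]
    exact ⟨rfl, rfl⟩

/-- A cocycle `α` extends to a cocycle `α + e_j ∧ β` exactly when `x_j α = dβ`. -/
theorem range_dropIndexCohomology (hj : j ∉ T) :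
    LinearMap.range (dropIndexCohomology x M (i + 1) hj) =
      LinearMap.ker (LinearMap.lsmul R (SubsetCohomology x M T (i + 1)) (x j)) := by
  ext z
  constructor
  · rintro ⟨w, rfl⟩
    obtain ⟨φ, rfl⟩ := Submodule.Quotient.mk_surjective _ w
    refine LinearMap.mem_ker.2 ((Submodule.mk_submoduleOf_eq_zero _).2 ?_)
    change x j • dropIndex R M j φ.1 ∈ _
    refine ⟨Submodule.smul_mem _ _ (dropIndex_mem_subsetCochains φ.2.1), contract R M j φ.1,
      fun S hS => ?_⟩
    have h : j ∉ S := fun h => hj (hS h)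
    have h2 := contract_wedge (x := x) h φ.1
    rw [φ.2.2 _ (Finset.insert_subset_insert _ hS), smul_zero] at h2
    rw [Pi.smul_apply, dropIndex_apply h]
    exact sub_eq_zero.1 h2.symm
  · intro h
    obtain ⟨α, rfl⟩ := Submodule.Quotient.mk_surjective _ z
    obtain ⟨h1, ψ', hψ'⟩ := (Submodule.mk_submoduleOf_eq_zero _).1 (LinearMap.mem_ker.1 h)
    obtain ⟨β, hβ, hβ2⟩ := exists_subsetCochain_of_eq_wedge h1 hψ'
    have hφ : α.1 + basisWedge R M j β ∈ subsetCocycles x M (insert j T) (i + 1) := by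
      refine ⟨add_mem (subsetCochains_mono (Finset.subset_insert _ _) α.2.1)
        (basisWedge_mem_subsetCochains hβ), forall_subset_insert_iff.2 fun S hS => ?_⟩
      have h : j ∉ S := fun h => hj (hS h)
      rw [map_add, Pi.add_apply, Pi.add_apply, α.2.2 S hS, wedge_basisWedge_of_notMem h,
        wedge_basisWedge h, wedge_insert_of_mem_subsetCochains hj α.2.1 h, ← hβ2 S hS]
      exact ⟨add_zero _, add_neg_cancel _⟩
    refine ⟨Submodule.Quotient.mk ⟨_, hφ⟩, congrArg Submodule.Quotient.mk (Subtype.ext ?_)⟩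
    change dropIndex R M j (α.1 + basisWedge R M j β) = α.1
    ext S
    by_cases h : j ∈ S
    · rw [dropIndex_apply_of_mem h, α.2.1 _ fun h' => hj (h'.1 h)]
    · rw [dropIndex_apply h, Pi.add_apply, basisWedge_apply_of_notMem h, add_zero]

theorem length_subsetCohomology_insert (hj : j ∉ T) :
    Module.length R (SubsetCohomology x M (insert j T) (i + 1)) =
      Module.length R (SubsetCohomology x M T i ⧸
        LinearMap.range (LinearMap.lsmul R (SubsetCohomology x M T i) (x j))) +
      Module.length R (LinearMap.ker (LinearMap.lsmul R (SubsetCohomology x M T (i + 1)) (x j))) := by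
  rw [Module.length_eq_quotient_ker_add_range _ _
    (exact_basisWedgeCohomology_dropIndexCohomology (x := x) (M := M) (i := i) hj),
    ker_basisWedgeCohomology, range_dropIndexCohomology]

end SubsetKoszul

/-! ### Length of Koszul cohomology when one element is changed -/

theorem Submodule.length_quotient_anti {R X : Type*} [Ring R] [AddCommGroup X] [Module R X]
    {A B : Submodule R X} (h : A ≤ B) : Module.length R (X ⧸ B) ≤ Module.length R (X ⧸ A) :=
  Module.length_le_of_surjective (Submodule.factor h) (Submodule.factor_surjective h)

theorem Submodule.length_mono {R X : Type*} [Ring R] [AddCommGroup X] [Module R X]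
    {A B : Submodule R X} (h : A ≤ B) : Module.length R A ≤ Module.length R B :=
  Module.length_le_of_injective (Submodule.inclusion h) (Submodule.inclusion_injective h)

/-- By Nakayama the submodules `a ^ n X` decrease strictly as long as they are nonzero; the length
of a quotient is the coheight of the submodule. -/
theorem le_length_quotient_range_pow {R X : Type*} [CommRing R] [IsLocalRing R]
    [AddCommGroup X] [Module R X] [Module.Finite R X] {a : R} (ha : a ∈ IsLocalRing.maximalIdeal R)
    (h : ∀ n, LinearMap.range (LinearMap.lsmul R X (a ^ n)) ≠ ⊥) (n : ℕ) :
    (n : ℕ∞) ≤ Module.length R (X ⧸ LinearMap.range (LinearMap.lsmul R X (a ^ n))) := by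
  rw [Module.length_quotient]
  induction n with
  | zero => exact zero_le
  | succ n ih =>
    rw [Nat.cast_add, Nat.cast_one]
    refine (add_le_add_left ih 1).trans (Order.coheight_add_one_le (lt_of_le_of_ne ?_ fun he => ?_))
    · rintro _ ⟨z, rfl⟩
      exact ⟨a • z, by simp only [LinearMap.lsmul_apply, pow_succ, mul_smul]⟩
    · have hfg : (LinearMap.range (LinearMap.lsmul R X (a ^ n))).FG := by
        rw [LinearMap.range_eq_map]
        exact Module.Finite.fg_top.map _
      refine h n (Submodule.eq_bot_of_le_smul_of_le_jacobson_bot (IsLocalRing.maximalIdeal R) _ hfg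
        ?_ (IsLocalRing.jacobson_eq_maximalIdeal ⊥ bot_ne_top).ge)
      nth_rw 1 [← he]
      rintro _ ⟨z, rfl⟩
      have : (LinearMap.lsmul R X (a ^ (n + 1))) z = a • (LinearMap.lsmul R X (a ^ n)) z := by
        simp [pow_succ', mul_smul]
      rw [this]
      exact Submodule.smul_mem_smul ha ⟨z, rfl⟩

section SubsetKoszul

variable {R : Type u} [CommRing R] {r : ℕ} {x y : Fin r → R} {M : Type w} [AddCommGroup M]
  [Module R M] {T : Finset (Fin r)} {i : ℕ} {j : Fin r}

/-- Since `c` kills the cohomology on `T`, `x j` acts there as `a * y j`. So it has a smaller image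
and a larger kernel than `y j`, and both terms of the length formula compare. -/
theorem length_subsetCohomology_insert_le (hj : j ∉ T) (h : ∀ l ∈ T, x l = y l) {a c : R}
    (hc : c ∈ Ideal.span (y '' T)) (hx : x j = a * y j + c) :
    Module.length R (SubsetCohomology y M (insert j T) (i + 1)) ≤
      Module.length R (SubsetCohomology x M (insert j T) (i + 1)) := by
  rw [length_subsetCohomology_insert hj, length_subsetCohomology_insert hj]
  unfold SubsetCohomology
  rw [subsetCocycles_congr h, subsetCocycles_congr h, subsetCoboundaries_congr h,
    subsetCoboundaries_congr h]
  have key : ∀ i (z : SubsetCohomology y M T i), x j • z = a • y j • z := fun i z => by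
    rw [hx, add_smul, smul_subsetCohomology_eq_zero hc, add_zero, mul_smul]
  refine add_le_add (Submodule.length_quotient_anti ?_) (Submodule.length_mono ?_)
  · rintro _ ⟨z, rfl⟩
    refine ⟨a • z, ?_⟩
    rw [LinearMap.lsmul_apply, LinearMap.lsmul_apply, key, smul_comm]
  · intro z hz
    rw [LinearMap.mem_ker, LinearMap.lsmul_apply] at hz ⊢
    rw [key, hz, smul_zero]

/-- Here `x j` acts as `a ^ n` on the cohomology on `T`, and the class of `φ` shows that no power of
`a` kills that cohomology. -/
theorem le_length_subsetCohomology_insert [IsLocalRing R] [IsNoetherianRing R]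
    [Module.Finite R M] (hj : j ∉ T) {a c : R} (ha : a ∈ IsLocalRing.maximalIdeal R) {n : ℕ}
    (hc : c ∈ Ideal.span (x '' T)) (hx : x j = a ^ n + c) {φ : Finset (Fin r) → M}
    (hφ : φ ∈ subsetCocycles x M T i) (hφ' : ∀ m, a ^ m • φ ∉ subsetCoboundaries x M T i) :
    (n : ℕ∞) ≤ Module.length R (SubsetCohomology x M (insert j T) (i + 1)) := by
  rw [length_subsetCohomology_insert hj]
  refine le_add_right ((le_length_quotient_range_pow ha (fun m hm => ?_) n).trans
    (Submodule.length_quotient_anti ?_))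
  · refine hφ' m ((Submodule.mk_submoduleOf_eq_zero (Z := subsetCocycles x M T i)
      (a ^ m • ⟨φ, hφ⟩)).1 ?_)
    rw [← Submodule.mem_bot R, ← hm]
    exact ⟨Submodule.Quotient.mk ⟨φ, hφ⟩, rfl⟩
  · rintro _ ⟨z, rfl⟩
    refine ⟨z, ?_⟩
    rw [LinearMap.lsmul_apply, LinearMap.lsmul_apply, hx, add_smul,
      smul_subsetCohomology_eq_zero hc, add_zero]

/-- The graded piece of degree `i` of a family indexed by all subsets. -/
def restrictDegree (R : Type u) [CommRing R] (r : ℕ) (M : Type w) [AddCommGroup M] [Module R M]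
    (i : ℕ) : (Finset (Fin r) → M) →ₗ[R] KoszulCochain r M i :=
  LinearMap.funLeft R M Subtype.val

theorem koszulD_restrictDegree (φ : Finset (Fin r) → M) :
    koszulD x M i (restrictDegree R r M i φ) = restrictDegree R r M (i + 1) (wedge x M φ) := by
  ext S
  exact Finset.sum_coe_sort S.1 fun l => (koszulSign R S.1 l * x l) • φ (S.1.erase l)

theorem restrictDegree_injOn {φ : Finset (Fin r) → M}
    (hφ : φ ∈ subsetCochains R M Finset.univ i) (h : restrictDegree R r M i φ = 0) : φ = 0 := by
  ext S
  by_cases hS : S.card = i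
  · exact congrFun h ⟨S, hS⟩
  · exact hφ S fun h => hS h.2

/-- Transfers lower bounds on length to `KoszulCohomology`, so injectivity of restriction to degree
`i` on cohomology is enough. -/
theorem length_subsetCohomology_univ_le : Module.length R (SubsetCohomology x M Finset.univ i) ≤
    Module.length R (KoszulCohomology x M i) := by
  classical
  refine Module.length_le_of_injective (Submodule.subquotientMap (restrictDegree R r M i)
    (fun φ hφ => ?_) fun φ hφ => ?_) ((injective_iff_map_eq_zero _).2 fun z hz => ?_)
  · refine LinearMap.mem_ker.2 ?_
    rw [koszulD_restrictDegree]
    ext S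
    exact hφ.2 S (Finset.subset_univ _)
  · obtain ⟨-, ψ, hψ⟩ := hφ
    obtain rfl : φ = wedge x M ψ := funext fun S => hψ S (Finset.subset_univ _)
    cases i with
    | zero =>
      refine (Submodule.mem_bot R).2 ?_
      ext S
      change wedge x M ψ S = 0
      rw [Finset.card_eq_zero.1 S.2]
      rfl
    | succ i => exact ⟨_, koszulD_restrictDegree ψ⟩
  · obtain ⟨⟨φ, hφ⟩, rfl⟩ := Submodule.Quotient.mk_surjective _ z
    rw [Submodule.mk_submoduleOf_eq_zero]
    have hz' : restrictDegree R r M i φ ∈ koszulCoboundaries x M i :=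
      (Submodule.mk_submoduleOf_eq_zero _).1 hz
    cases i with
    | zero =>
      have : φ = 0 := restrictDegree_injOn hφ.1 hz'
      exact this ▸ zero_mem _
    | succ i =>
      obtain ⟨χ, hχ⟩ := hz'
      refine ⟨hφ.1, fun S => if h : S.card = i then χ ⟨S, h⟩ else 0, fun S _ => ?_⟩
      by_cases hc : S.card = i + 1
      · refine (congrFun hχ ⟨S, hc⟩).symm.trans ?_
        rw [wedge_apply, ← Finset.sum_coe_sort]
        refine Finset.sum_congr rfl fun l _ => ?_
        rw [dif_pos]
      · change φ S = _
        rw [hφ.1 S fun h => hc h.2]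
        refine (Finset.sum_eq_zero fun l hl => ?_).symm
        dsimp only
        rw [dif_neg fun h => hc ?_, smul_zero]
        rw [← h, Finset.card_erase_add_one hl]

end SubsetKoszul

/-! ### Functoriality of the Koszul differential -/

section SubsetKoszul

variable {R : Type u} [CommRing R] {r : ℕ} {x : Fin r → R} {M : Type w} [AddCommGroup M]
  [Module R M] {T : Finset (Fin r)} {i : ℕ}

/-- Induction on `S`: Cartan's formula at `insert j S`, used twice, leaves terms at `S` that cancel
or vanish by induction. -/
theorem wedge_wedge (φ : Finset (Fin r) → M) (S : Finset (Fin r)) :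
    wedge x M (wedge x M φ) S = 0 := by
  induction S using Finset.induction_on generalizing φ with
  | empty => rfl
  | insert j S hj ih =>
    have h : wedge x M (contract R M j (wedge x M φ)) S =
        wedge x M (x j • φ - wedge x M (contract R M j φ)) S := by
      refine wedge_congr (fun _ _ => rfl) fun U hU => ?_
      have hU' : j ∉ U := fun h => hj (hU h)
      rw [contract_apply hU', contract_wedge hU']
      rfl
    rw [wedge_insert hj, h, map_sub, map_smul, Pi.sub_apply, Pi.smul_apply, ih, sub_zero, sub_self,
      smul_zero]

theorem wedge_comp_linearMap {N : Type*} [AddCommGroup N] [Module R N] (g : M →ₗ[R] N)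
    (φ : Finset (Fin r) → M) (S : Finset (Fin r)) :
    wedge x N (fun U => g (φ U)) S = g (wedge x M φ S) := by
  simp [wedge_apply]

theorem wedge_algebraMap {A : Type*} [CommRing A] [Algebra R A] [Module A M] [IsScalarTower R A M]
    (φ : Finset (Fin r) → M) (S : Finset (Fin r)) :
    wedge (fun j => algebraMap R A (x j)) M φ S = wedge x M φ S := by
  refine Finset.sum_congr rfl fun j _ => ?_
  have : koszulSign A S j = algebraMap R A (koszulSign R S j) := by simp [koszulSign]
  rw [this, ← map_mul, algebraMap_smul]

theorem wedge_eq_zero_of_card_ne {φ : Finset (Fin r) → M} (hφ : φ ∈ subsetCochains R M T i)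
    {S : Finset (Fin r)} (hS : S.card ≠ i + 1) : wedge x M φ S = 0 :=
  Finset.sum_eq_zero fun l hl => by
    rw [hφ _ fun h => hS ?_, smul_zero]
    rw [← h.2, Finset.card_erase_add_one hl]

end SubsetKoszul

/-! ### Koszul nonvanishing from associated primes, and localization -/

section Depth

variable {R : Type u} [CommRing R]

/-- If `P` is associated to `N` and `y` is a nonzerodivisor on `N`, some associated prime of
`N / y N` contains both `P` and `y`. -/
theorem exists_associatedPrime_quotient_smul_top [IsNoetherianRing R] [IsLocalRing R]
    {N : Type w} [AddCommGroup N]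
    [Module R N] [Module.Finite R N] {P : Ideal R} (hP : P ∈ associatedPrimes R N) {y : R}
    (hy : y ∈ IsLocalRing.maximalIdeal R) (hreg : ∀ n : N, y • n = 0 → n = 0) :
    ∃ P' ∈ associatedPrimes R (N ⧸ LinearMap.range (LinearMap.lsmul R N y)), P ≤ P' ∧ y ∈ P' := by
  obtain ⟨hP, z, hPz⟩ := isAssociatedPrime_iff.1 hP
  have hz : ∀ a ∈ P, a • z = 0 := fun a ha => by
    rw [hPz] at ha
    simpa [Submodule.mem_colon_singleton] using ha
  have hz0 : z ≠ 0 := by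
    rintro rfl
    exact hP.ne_top (hPz.trans (by simp))
  let Z : Submodule R N := Submodule.torsionBySet R N P
  have hZ : ∀ n, n ∈ Z ↔ ∀ a ∈ P, a • n = 0 := fun n => by
    simp [Z, Submodule.mem_torsionBySet_iff]
  -- If the `P`-torsion `Z` lay in `yN`, then `Z = yZ` because `y` is a nonzerodivisor, and Nakayama
  -- would give `Z = 0`.
  obtain ⟨n, hn, hn'⟩ : ∃ n ∈ Z, n ∉ LinearMap.range (LinearMap.lsmul R N y) := by
    by_contra! h
    have : Z = ⊥ := by
      refine Submodule.eq_bot_of_le_smul_of_le_jacobson_bot (IsLocalRing.maximalIdeal R) _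
        (IsNoetherian.noetherian Z) (fun n hn => ?_)
        (IsLocalRing.jacobson_eq_maximalIdeal ⊥ bot_ne_top).ge
      obtain ⟨n', rfl⟩ := h n hn
      refine Submodule.smul_mem_smul hy ((hZ _).2 fun a ha => hreg _ ?_)
      rw [smul_comm]
      exact (hZ _).1 hn a ha
    exact hz0 ((Submodule.mem_bot R).1 (this ▸ (hZ z).2 hz))
  obtain ⟨P', hP', h⟩ := exists_le_isAssociatedPrime_of_isNoetherianRing R
    (Submodule.Quotient.mk n : N ⧸ LinearMap.range (LinearMap.lsmul R N y))
    (by rwa [ne_eq, Submodule.Quotient.mk_eq_zero])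
  refine ⟨P', hP', fun a ha => h ?_, h ?_⟩
  · rw [Submodule.mem_colon_singleton, ← Submodule.Quotient.mk_smul, (hZ n).1 hn a ha]
    simp
  · rw [Submodule.mem_colon_singleton, ← Submodule.Quotient.mk_smul, Submodule.mem_bot,
      Submodule.Quotient.mk_eq_zero]
    exact ⟨n, rfl⟩

variable {r : ℕ} {T : Finset (Fin r)}

theorem exists_subsetCocycle_zero {x : Fin r → R} {N : Type w} [AddCommGroup N] [Module R N]
    {z : N} (hz : z ≠ 0) (h : ∀ j ∈ T, x j • z = 0) :
    ∃ φ ∈ subsetCocycles x N T 0, φ ∉ subsetCoboundaries x N T 0 := by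
  classical
  refine ⟨Pi.single ∅ z, ⟨fun S hS => ?_, fun S hS => Finset.sum_eq_zero fun l hl => ?_⟩, ?_⟩
  · rw [Pi.single_eq_of_ne]
    rintro rfl
    exact hS ⟨Finset.empty_subset _, rfl⟩
  · by_cases hc : S.erase l = ∅
    · rw [hc, Pi.single_eq_same, mul_smul, h l (hS hl), smul_zero]
    · rw [Pi.single_eq_of_ne hc, smul_zero]
  · rintro ⟨-, ψ, hψ⟩
    have := hψ ∅ (Finset.empty_subset _)
    rw [Pi.single_eq_same] at this
    exact hz this

/-- If the Koszul cohomology of `N / y N` does not vanish in degree `i`, that of `N` does not vanish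
in degree `i` or `i + 1`. -/
theorem exists_subsetCocycle_of_quotient {x : Fin r → R} {N : Type w} [AddCommGroup N]
    [Module R N] {y : R} (hreg : ∀ n : N, y • n = 0 → n = 0) {i : ℕ}
    {φ : Finset (Fin r) → N ⧸ LinearMap.range (LinearMap.lsmul R N y)}
    (hφ : φ ∈ subsetCocycles x _ T i) (hφ' : φ ∉ subsetCoboundaries x _ T i) :
    ∃ k ≤ i + 1, ∃ φ ∈ subsetCocycles x N T k, φ ∉ subsetCoboundaries x N T k := by
  classical
  have hlift : ∀ S, ∃ n : N, Submodule.Quotient.mk n = φ S ∧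
      (¬ (S ⊆ T ∧ S.card = i) → n = 0) := fun S => by
    by_cases hS : S ⊆ T ∧ S.card = i
    · obtain ⟨n, hn⟩ := Submodule.Quotient.mk_surjective _ (φ S)
      exact ⟨n, hn, fun h => absurd hS h⟩
    · exact ⟨0, (hφ.1 S hS).symm, fun _ => rfl⟩
  choose χ hχ hχ0 using hlift
  -- Connecting homomorphism of `0 → N → N → N / yN → 0`: lift `φ` to `χ`, then divide `dχ` by `y`.
  have hdiv : ∀ S, ∃ n : N, (S ⊆ T → y • n = wedge x N χ S) ∧
      (¬ (S ⊆ T ∧ S.card = i + 1) → n = 0) := fun S => by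
    by_cases hS : S ⊆ T ∧ S.card = i + 1
    · have h := hφ.2 S hS.1
      rw [← funext hχ] at h
      change wedge x _ (fun U => Submodule.mkQ _ (χ U)) S = 0 at h
      rw [wedge_comp_linearMap, Submodule.mkQ_apply, Submodule.Quotient.mk_eq_zero] at h
      obtain ⟨n, hn⟩ := h
      exact ⟨n, fun _ => hn, fun h => absurd hS h⟩
    · refine ⟨0, fun h => ?_, fun _ => rfl⟩
      rw [wedge_eq_zero_of_card_ne (T := T) hχ0 fun h' => hS ⟨h, h'⟩, smul_zero]
  choose ψ hψ hψ0 using hdiv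
  have hψZ : ψ ∈ subsetCocycles x N T (i + 1) := by
    refine ⟨hψ0, fun S hS => hreg _ ?_⟩
    rw [← Pi.smul_apply, ← map_smul, ← wedge_wedge (x := x) χ S]
    exact wedge_congr (fun _ _ => rfl) fun U hU => hψ U (hU.trans hS)
  -- Either the connecting class is nonzero in degree `i + 1`, or `ψ = dξ` and `χ - yξ` is a cocycle
  -- of degree `i` lifting `φ`.
  by_cases hψB : ψ ∈ subsetCoboundaries x N T (i + 1)
  · obtain ⟨-, ξ', hξ'⟩ := hψB
    obtain ⟨ξ, hξ, hξ2⟩ := exists_subsetCochain_of_eq_wedge hψ0 hξ'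
    refine ⟨i, Nat.le_succ i, χ - y • ξ, ⟨sub_mem hχ0 (Submodule.smul_mem _ _ hξ),
      fun S hS => ?_⟩, ?_⟩
    · rw [map_sub, map_smul, Pi.sub_apply, Pi.smul_apply, ← hξ2 S hS, hψ S hS, sub_self]
    · rintro ⟨-, ζ, hζ⟩
      refine hφ' ⟨hφ.1, fun U => Submodule.mkQ _ (ζ U), fun S hS => ?_⟩
      rw [wedge_comp_linearMap, ← hζ S hS, ← hχ, Submodule.mkQ_apply]
      refine (Submodule.Quotient.eq _).2 ?_
      rw [Pi.sub_apply, sub_sub_cancel]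
      exact ⟨_, rfl⟩
  · exact ⟨i + 1, le_rfl, ψ, hψZ, hψB⟩

/-- The depth of a module is at most the dimension of `R / P`, for every associated prime `P`. -/
theorem exists_subsetCocycle_of_coheight_le [IsNoetherianRing R] [IsLocalRing R]
    {x : Fin r → R}
    (hx : ∀ j ∈ T, x j ∈ IsLocalRing.maximalIdeal R) (t : ℕ) {N : Type w} [AddCommGroup N]
    [Module R N] [Module.Finite R N] {P : PrimeSpectrum R} (hP : P.asIdeal ∈ associatedPrimes R N)
    (ht : Order.coheight P ≤ t) :
    ∃ k ≤ t, ∃ φ ∈ subsetCocycles x N T k, φ ∉ subsetCoboundaries x N T k := by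
  induction t generalizing N P with
  | zero =>
    obtain ⟨-, z, hz⟩ := isAssociatedPrime_iff.1 hP
    have hP : P = IsLocalRing.closedPoint R := by
      have : IsMax P := Order.coheight_eq_zero.1 (by simpa using ht)
      exact le_antisymm (IsLocalRing.le_maximalIdeal P.2.ne_top)
        (this (IsLocalRing.le_maximalIdeal P.2.ne_top))
    refine ⟨0, le_rfl, exists_subsetCocycle_zero (z := z) ?_ fun j hj => ?_⟩
    · rintro rfl
      exact P.2.ne_top (hz.trans (by simp))
    · have : x j ∈ P.asIdeal := hP ▸ hx j hj
      rw [hz] at this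
      simpa [Submodule.mem_colon_singleton] using this
  | succ t ih =>
    by_cases hm : IsLocalRing.maximalIdeal R ∈ associatedPrimes R N
    · obtain ⟨hp, z, hz⟩ := isAssociatedPrime_iff.1 hm
      refine ⟨0, Nat.zero_le _, exists_subsetCocycle_zero (z := z) ?_ fun j hj => ?_⟩
      · rintro rfl
        exact hp.ne_top (hz.trans (by simp))
      · have := hx j hj
        rw [hz] at this
        simpa [Submodule.mem_colon_singleton] using this
    · obtain ⟨y, hy, hreg⟩ : ∃ y ∈ IsLocalRing.maximalIdeal R, ∀ n : N, y • n = 0 → n = 0 := by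
        by_contra! h
        obtain ⟨P, hP, hmP⟩ : ∃ P ∈ associatedPrimes R N, IsLocalRing.maximalIdeal R ≤ P := by
          refine ((IsLocalRing.maximalIdeal R).subset_union_prime_finite
            (associatedPrimes.finite R N) (f := id) 0 0 fun _ h _ _ ↦ h.1).1 ?_
          simp only [id]
          rw [biUnion_associatedPrimes_eq_zero_divisors]
          intro y hy
          obtain ⟨n, hn⟩ := h y hy
          exact ⟨n, hn.2, hn.1⟩
        exact hm (le_antisymm (IsLocalRing.le_maximalIdeal hP.1.ne_top) hmP ▸ hP)
      obtain ⟨P', hP', hle, hyP'⟩ := exists_associatedPrime_quotient_smul_top hP hy hreg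
      have hyP : y ∉ P.asIdeal := by
        obtain ⟨hp, z, hz⟩ := isAssociatedPrime_iff.1 hP
        intro hyP
        rw [hz] at hyP
        have hz0 := hreg z (by simpa [Submodule.mem_colon_singleton] using hyP)
        exact hp.ne_top (hz.trans (by simp [hz0]))
      -- The nonzerodivisor `y` lies in `P'` but not in `P`, so the coheight drops and induction
      -- applies to `N / yN`.
      have hlt : P < ⟨P', hP'.1⟩ := lt_of_le_of_ne hle fun h => hyP (h ▸ hyP')
      have ht' : Order.coheight (⟨P', hP'.1⟩ : PrimeSpectrum R) ≤ t := by
        have := (Order.coheight_add_one_le hlt).trans ht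
        rw [Nat.cast_add, Nat.cast_one] at this
        exact (ENat.add_le_add_iff_right ENat.one_ne_top).1 this
      obtain ⟨k, hk, φ, hφ, hφ'⟩ := ih (N := N ⧸ LinearMap.range (LinearMap.lsmul R N y))
        (P := ⟨P', hP'.1⟩) hP' ht'
      obtain ⟨l, hl, h⟩ := exists_subsetCocycle_of_quotient hreg hφ hφ'
      exact ⟨l, by omega, h⟩

/-- Koszul cohomology classes of a localization come from classes that survive localization. -/
theorem exists_subsetCocycle_of_localizedModule {x : Fin r → R} {M : Type w} [AddCommGroup M]
    [Module R M] (S : Submonoid R) {i : ℕ} {φ : Finset (Fin r) → LocalizedModule S M}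
    (hφ : φ ∈ subsetCocycles (fun j => algebraMap R (Localization S) (x j)) _ T i)
    (hφ' : φ ∉ subsetCoboundaries (fun j => algebraMap R (Localization S) (x j)) _ T i) :
    ∃ ψ ∈ subsetCocycles x M T i, ∀ s ∈ S, s • ψ ∉ subsetCoboundaries x M T i := by
  classical
  let f := LocalizedModule.mkLinearMap S M
  obtain ⟨b, hb⟩ := IsLocalizedModule.exist_integer_multiples_of_finite S f φ
  have hlift : ∀ U, ∃ n : M, f n = b.1 • φ U ∧ (¬ (U ⊆ T ∧ U.card = i) → n = 0) := fun U => by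
    by_cases hU : U ⊆ T ∧ U.card = i
    · obtain ⟨n, hn⟩ := hb U
      exact ⟨n, hn, fun h => absurd hU h⟩
    · exact ⟨0, by rw [hφ.1 U hU, map_zero, smul_zero], fun _ => rfl⟩
  choose χ hχ hχ0 using hlift
  have hker : ∀ U, ∃ s : S, U ⊆ T → s • wedge x M χ U = 0 := fun U => by
    by_cases hU : U ⊆ T
    · have h : f (wedge x M χ U) = 0 := by
        rw [← wedge_comp_linearMap, funext hχ]
        change wedge x _ (b.1 • φ) U = 0
        rw [map_smul, Pi.smul_apply, ← wedge_algebraMap (A := Localization S), hφ.2 U hU, smul_zero]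
      obtain ⟨s, hs⟩ := (IsLocalizedModule.eq_zero_iff S f).1 h
      exact ⟨s, fun _ => hs⟩
    · exact ⟨1, fun h => absurd h hU⟩
  choose c hc using hker
  -- After the denominator `b` is cleared, `dχ` vanishes only up to `S`-torsion; the product of the
  -- finitely many `c U` kills all its values.
  refine ⟨(∏ U, c U : S) • χ, ⟨Submodule.smul_mem _ ((∏ U, c U : S) : R) hχ0, fun U hU => ?_⟩,
    fun s hs => ?_⟩
  · change wedge x M (((∏ U, c U : S) : R) • χ) U = 0
    rw [map_smul, Pi.smul_apply, ← Finset.prod_erase_mul _ _ (Finset.mem_univ U), Submonoid.coe_mul,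
      mul_smul]
    have := hc U hU
    rw [Submonoid.smul_def] at this
    rw [this, smul_zero]
  · rintro ⟨-, ξ, hξ⟩
    let e : S := ⟨s, hs⟩ * (∏ U, c U) * b
    have hu : IsUnit (algebraMap R (Localization S) e) := IsLocalization.map_units _ e
    have h : algebraMap R (Localization S) e • φ ∈
        subsetCoboundaries (fun j => algebraMap R (Localization S) (x j)) _ T i := by
      refine ⟨Submodule.smul_mem _ _ hφ.1, fun U => f (ξ U), fun U hU => ?_⟩
      rw [wedge_algebraMap, wedge_comp_linearMap, ← hξ U hU, Pi.smul_apply, algebraMap_smul,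
        Pi.smul_apply, Pi.smul_apply, Submonoid.smul_def, map_smul, map_smul, hχ, smul_smul,
        smul_smul]
      rfl
    refine hφ' ?_
    have := Submodule.smul_mem _ (hu.unit⁻¹ : (Localization S)ˣ).1 h
    rwa [smul_smul, IsUnit.val_inv_mul, one_smul] at this

/-- Apply the depth bound to `M_Q` and pull the class back. The degree improves from `t + 1` to `t`
because chains of primes from `P` up to `Q` can be extended by the maximal ideal. -/
theorem exists_subsetCocycle_of_le_prime [IsNoetherianRing R] [IsLocalRing R]
    {x : Fin r → R} {M : Type w}
    [AddCommGroup M] [Module R M] [Module.Finite R M] {P Q : PrimeSpectrum R} (hPQ : P ≤ Q)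
    (hQ : Q ≠ IsLocalRing.closedPoint R) (hP : P.asIdeal ∈ associatedPrimes R M)
    (hx : ∀ j ∈ T, x j ∈ Q.asIdeal) {t : ℕ} (ht : Order.coheight P ≤ t + 1) :
    ∃ k ≤ t, ∃ φ ∈ subsetCocycles x M T k, ∀ s ∉ Q.asIdeal,
      s • φ ∉ subsetCoboundaries x M T k := by
  have hdisj : Disjoint (Q.asIdeal.primeCompl : Set R) P.asIdeal :=
    Set.disjoint_left.2 fun a ha ha' => ha (hPQ ha')
  let P' : PrimeSpectrum (Localization.AtPrime Q.asIdeal) :=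
    ⟨P.asIdeal.map (algebraMap R _), IsLocalization.isPrime_of_isPrime_disjoint Q.asIdeal.primeCompl
      _ _ P.2 hdisj⟩
  have hcomap : P'.asIdeal.comap (algebraMap R _) = P.asIdeal :=
    IsLocalization.under_map_of_isPrime_disjoint Q.asIdeal.primeCompl _ P.2 hdisj
  have hP' : P'.asIdeal ∈ associatedPrimes (Localization.AtPrime Q.asIdeal)
      (LocalizedModule Q.asIdeal.primeCompl M) :=
    Module.associatedPrimes.mem_associatedPrimes_of_comap_mem_associatedPrimes_of_isLocalizedModule
      Q.asIdeal.primeCompl (LocalizedModule.mkLinearMap Q.asIdeal.primeCompl M) _ (hcomap ▸ hP)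
  have hmono : StrictMono (PrimeSpectrum.comap (algebraMap R (Localization.AtPrime Q.asIdeal))) := by
    refine Monotone.strictMono_of_injective (fun _ _ h => Ideal.comap_mono h)
      (PrimeSpectrum.localization_comap_injective _ Q.asIdeal.primeCompl)
  have hlt : ∀ p, PrimeSpectrum.comap (algebraMap R (Localization.AtPrime Q.asIdeal)) p <
      IsLocalRing.closedPoint R := fun p => by
    refine lt_of_le_of_lt (b := Q) ?_ (lt_of_le_of_ne (IsLocalRing.le_maximalIdeal Q.2.ne_top) hQ)
    have := PrimeSpectrum.localization_comap_range (Localization.AtPrime Q.asIdeal)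
      Q.asIdeal.primeCompl
    have h : PrimeSpectrum.comap (algebraMap R (Localization.AtPrime Q.asIdeal)) p ∈
      Set.range (PrimeSpectrum.comap (algebraMap R (Localization.AtPrime Q.asIdeal))) := ⟨p, rfl⟩
    rw [this] at h
    intro a ha
    by_contra ha'
    exact Set.disjoint_left.1 h ha' ha
  have ht' : Order.coheight P' ≤ t := by
    refine Order.coheight_le fun p hp => ?_
    have hmap : (p.map _ hmono).head = P :=
      (congrArg (PrimeSpectrum.comap (algebraMap R _)) hp).trans (PrimeSpectrum.ext hcomap)
    have hhead : P = ((p.map _ hmono).snoc _ (hlt p.last)).head :=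
      ((RelSeries.head_snoc _ _ _).trans hmap).symm
    have h : ((p.length + 1 : ℕ) : ℕ∞) ≤ t + 1 :=
      (Order.length_le_coheight hhead.le).trans ht
    exact_mod_cast Nat.le_of_succ_le_succ (by exact_mod_cast h)
  obtain ⟨k, hk, φ, hφ, hφ'⟩ := exists_subsetCocycle_of_coheight_le (T := T)
    (x := fun j => algebraMap R (Localization.AtPrime Q.asIdeal) (x j))
    (fun j hj => (IsLocalization.AtPrime.to_map_mem_maximal_iff _ Q.asIdeal _).2 (hx j hj)) t hP' ht'
  obtain ⟨ψ, hψ, hψ'⟩ := exists_subsetCocycle_of_localizedModule Q.asIdeal.primeCompl hφ hφ'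
  exact ⟨k, hk, ψ, hψ, fun s hs => hψ' s hs⟩

end Depth

/-! ### Systems of parameters adapted to a prime, and lengths of quotients -/

section Parameters

variable {R : Type u} [CommRing R]

theorem Ideal.exists_mem_forall_notMem_of_finite {I : Ideal R} {s : Set (Ideal R)} (hs : s.Finite)
    (hp : ∀ p ∈ s, p.IsPrime) (h : ∀ p ∈ s, ¬ I ≤ p) : ∃ a ∈ I, ∀ p ∈ s, a ∉ p := by
  by_contra! hI
  obtain ⟨p, hps, hle⟩ := (I.subset_union_prime_finite hs (f := id) 0 0
    fun p hps _ _ => hp p hps).1 fun a ha => by simpa using hI a ha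
  exact h p hps hle

/-- Each new element of `Q` avoids the minimal primes over the previous ones that do not contain
`Q`. Above such a prime the coheight drops; above `Q` it is at most one, which `k + 1 ≤ d` absorbs.
-/
theorem exists_seq_coheight_add_le [IsNoetherianRing R] [IsLocalRing R] {d : ℕ}
    (hd : ringKrullDim R ≤ d) {Q : PrimeSpectrum R} (hQ : Order.coheight Q ≤ 1) {k : ℕ}
    (hk : k + 1 ≤ d) : ∃ f : ℕ → R, (∀ j, f j ∈ Q.asIdeal) ∧
      ∀ p : PrimeSpectrum R, (∀ j < k, f j ∈ p.asIdeal) → Order.coheight p + k ≤ d := by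
  induction k with
  | zero =>
    refine ⟨0, fun _ => zero_mem _, fun p _ => ?_⟩
    rw [Nat.cast_zero, add_zero]
    exact_mod_cast (Order.coheight_le_krullDim p).trans hd
  | succ k ih =>
    obtain ⟨f, hf, hf'⟩ := ih (by omega)
    obtain ⟨a, haQ, ha⟩ := Ideal.exists_mem_forall_notMem_of_finite (I := Q.asIdeal)
      (s := {q ∈ (Ideal.span (f '' Set.Iio k)).minimalPrimes | ¬ Q.asIdeal ≤ q})
      ((Ideal.finite_minimalPrimes_of_isNoetherianRing R _).subset (Set.sep_subset _ _))
      (fun p hp => hp.1.1.1) fun p hp => hp.2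
    refine ⟨Function.update f k a, fun j => ?_, fun p hp => ?_⟩
    · by_cases hj : j = k
      · subst hj
        rwa [Function.update_self]
      · rw [Function.update_of_ne hj]
        exact hf j
    · have hp' : ∀ j < k, f j ∈ p.asIdeal := fun j hj => by
        simpa [Function.update_of_ne hj.ne] using hp j (by omega)
      have hak : a ∈ p.asIdeal := by simpa using hp k (by omega)
      have hle : Ideal.span (f '' Set.Iio k) ≤ p.asIdeal := by
        rw [Ideal.span_le]
        rintro _ ⟨j, hj, rfl⟩
        exact hp' j hj
      obtain ⟨q, hq, hqp⟩ := Ideal.exists_minimalPrimes_le hle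
      rw [Nat.cast_add, Nat.cast_one]
      by_cases hQq : Q.asIdeal ≤ q
      · have h : Order.coheight p ≤ 1 := (Order.coheight_anti (show Q ≤ p from hQq.trans hqp)).trans hQ
        calc Order.coheight p + (k + 1) ≤ 1 + (k + 1) := by gcongr
          _ = ((k + 1 + 1 : ℕ) : ℕ∞) := by push_cast; ring
          _ ≤ d := by exact_mod_cast hk
      · have hlt : (⟨q, hq.1.1⟩ : PrimeSpectrum R) < p :=
          lt_of_le_of_ne hqp fun h => ha q ⟨hq, hQq⟩ (by rw [← h] at hak; exact hak)
        calc Order.coheight p + (k + 1) = Order.coheight p + 1 + k := by ring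
          _ ≤ Order.coheight (⟨q, hq.1.1⟩ : PrimeSpectrum R) + k := by
            gcongr
            exact Order.coheight_add_one_le hlt
          _ ≤ d := hf' _ fun j hj => hq.1.2 (Ideal.subset_span ⟨j, hj, rfl⟩)

/-- A prime of coheight one contains all but one element of some system of parameters. -/
theorem exists_parameters_of_coheight_le_one [IsNoetherianRing R] [IsLocalRing R] {e : ℕ}
    (hd : ringKrullDim R ≤ (e + 1 : ℕ)) {Q : PrimeSpectrum R} (hQ : Order.coheight Q ≤ 1)
    (hQm : Q ≠ IsLocalRing.closedPoint R) :
    ∃ (f : ℕ → R) (a : R), (∀ j, f j ∈ Q.asIdeal) ∧ a ∈ IsLocalRing.maximalIdeal R ∧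
      a ∉ Q.asIdeal ∧ ∀ p : PrimeSpectrum R, (∀ j < e, f j ∈ p.asIdeal) → a ∈ p.asIdeal →
        p = IsLocalRing.closedPoint R := by
  obtain ⟨f, hf, hf'⟩ := exists_seq_coheight_add_le hd hQ (k := e) le_rfl
  -- Minimal primes over the `f j` have coheight at most one, so a prime strictly above one of them
  -- is maximal. Hence `a` need only avoid the nonmaximal ones, and `Q`.
  obtain ⟨a, ham, ha⟩ := Ideal.exists_mem_forall_notMem_of_finite
    (I := IsLocalRing.maximalIdeal R)
    (s := insert Q.asIdeal
      {q ∈ (Ideal.span (f '' Set.Iio e)).minimalPrimes | ¬ IsLocalRing.maximalIdeal R ≤ q})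
    (((Ideal.finite_minimalPrimes_of_isNoetherianRing R _).subset (Set.sep_subset _ _)).insert _)
    (by
      rintro p (rfl | hp)
      · exact Q.2
      · exact hp.1.1.1)
    (by
      rintro p (rfl | hp)
      · exact fun h => hQm (le_antisymm (IsLocalRing.le_maximalIdeal Q.2.ne_top) h)
      · exact hp.2)
  refine ⟨f, a, hf, ham, ha _ (Set.mem_insert _ _), fun p hp hap => ?_⟩
  have hle : Ideal.span (f '' Set.Iio e) ≤ p.asIdeal := by
    rw [Ideal.span_le]
    rintro _ ⟨j, hj, rfl⟩
    exact hp j hj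
  obtain ⟨q, hq, hqp⟩ := Ideal.exists_minimalPrimes_le hle
  have hmax : IsLocalRing.maximalIdeal R ≤ p.asIdeal := by
    by_cases hmq : IsLocalRing.maximalIdeal R ≤ q
    · exact hmq.trans hqp
    · have hlt : (⟨q, hq.1.1⟩ : PrimeSpectrum R) < p := lt_of_le_of_ne hqp fun h =>
        ha q (Set.mem_insert_of_mem _ ⟨hq, hmq⟩) (by rw [← h] at hap; exact hap)
      have h1 := hf' ⟨q, hq.1.1⟩ fun j hj => hq.1.2 (Ideal.subset_span ⟨j, hj, rfl⟩)
      have h2 : Order.coheight p + (e + 1 : ℕ) ≤ (0 : ℕ∞) + (e + 1 : ℕ) := by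
        rw [zero_add]
        refine le_trans ?_ h1
        rw [Nat.cast_add, Nat.cast_one, add_comm (e : ℕ∞), ← add_assoc]
        gcongr
        exact Order.coheight_add_one_le hlt
      have h3 : IsMax p := Order.coheight_eq_zero.1
        (le_antisymm ((ENat.add_le_add_iff_right (ENat.natCast_ne_top _)).1 h2) zero_le)
      exact h3 (b := IsLocalRing.closedPoint R) (IsLocalRing.le_maximalIdeal p.2.ne_top)
  exact le_antisymm (IsLocalRing.le_maximalIdeal p.2.ne_top) hmax

theorem length_quotient_ne_top [IsNoetherianRing R] [IsLocalRing R] {I : Ideal R}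
    (hI : I ≤ IsLocalRing.maximalIdeal R)
    (h : ∀ p : PrimeSpectrum R, I ≤ p.asIdeal → p = IsLocalRing.closedPoint R) :
    Module.length R (R ⧸ I) ≠ ⊤ := by
  have hmin : IsLocalRing.maximalIdeal R ∈ I.minimalPrimes :=
    ⟨⟨inferInstance, hI⟩, fun p hp _ =>
      (congrArg PrimeSpectrum.asIdeal (h ⟨p, hp.1⟩ hp.2)).ge⟩
  have := IsLocalRing.quotient_artinian_of_mem_minimalPrimes_of_isLocalRing I hmin
  rw [Module.length_eq_of_surjective (S := R) (R := R ⧸ I) Ideal.Quotient.mk_surjective]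
  exact Module.length_ne_top

/-- Multiplication by `a` maps `R ⧸ B` to `R ⧸ I`, and its cokernel `R ⧸ (I ⊔ (a))` is a quotient of
`R ⧸ I'`. -/
theorem length_quotient_le_add {I I' B : Ideal R} {a : R} (hI' : I' ≤ I ⊔ Ideal.span {a})
    (hB : ∀ b ∈ B, a * b ∈ I) :
    Module.length R (R ⧸ I) ≤ Module.length R (R ⧸ I') + Module.length R (R ⧸ B) := by
  let f : (R ⧸ B) →ₗ[R] (R ⧸ I) := Submodule.mapQ B I (LinearMap.lsmul R R a) hB
  rw [Module.length_eq_quotient_ker_add_range f (LinearMap.range f).mkQ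
    (LinearMap.exact_map_mkQ_range f), add_comm]
  refine add_le_add ?_ (Module.length_le_of_surjective _ (Submodule.mkQ_surjective _))
  rw [Submodule.range_mkQ, Module.length_top]
  have hle : I' ≤ LinearMap.ker ((LinearMap.range f).mkQ ∘ₗ I.mkQ) := by
    refine hI'.trans (sup_le (fun b hb => ?_) ((Ideal.span_singleton_le_iff_mem _).2 ?_))
    · have h : I.mkQ b = 0 := (Submodule.Quotient.mk_eq_zero I).2 hb
      rw [LinearMap.mem_ker, LinearMap.comp_apply, h, map_zero]
    · refine (Submodule.Quotient.mk_eq_zero _).2 ⟨Submodule.Quotient.mk 1, ?_⟩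
      exact congrArg _ (mul_one a)
  refine Module.length_le_of_surjective (Submodule.liftQ I' _ hle) fun z => ?_
  obtain ⟨z, rfl⟩ := Submodule.mkQ_surjective _ z
  obtain ⟨b, rfl⟩ := Submodule.mkQ_surjective _ z
  exact ⟨Submodule.Quotient.mk b, rfl⟩

theorem length_quotient_sup_span_pow_le (J : Ideal R) (a : R) (n : ℕ) :
    Module.length R (R ⧸ J ⊔ Ideal.span {a ^ n}) ≤
      n * Module.length R (R ⧸ J ⊔ Ideal.span {a}) := by
  induction n with
  | zero =>
    have : Subsingleton (R ⧸ J ⊔ Ideal.span {a ^ 0}) := by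
      rw [Ideal.Quotient.subsingleton_iff]
      simp
    rw [Module.length_eq_zero]
    exact zero_le
  | succ n ih =>
    refine (length_quotient_le_add (I' := J ⊔ Ideal.span {a ^ n}) (B := J ⊔ Ideal.span {a})
      (a := a ^ n) ?_ fun b hb => ?_).trans ?_
    · exact sup_le_sup_right le_sup_left _
    · obtain ⟨j, hj, c, hc, rfl⟩ := Submodule.mem_sup.1 hb
      obtain ⟨c, rfl⟩ := Ideal.mem_span_singleton'.1 hc
      rw [mul_add]
      refine add_mem (Ideal.mem_sup_left (Ideal.mul_mem_left _ _ hj))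
        (Ideal.mem_sup_right (Ideal.mem_span_singleton'.2 ⟨c, by ring⟩))
    · rw [Nat.cast_add, Nat.cast_one, add_mul, one_mul]
      exact add_le_add_left ih _

/-! ### The parameter ideals that violate effaceability -/

/-- The parameters `f_1 a ^ n + f_0 ^ n, …, f_e a ^ n + f_(e-1) ^ n, a ^ N + f_e ^ n`, with the
first `k` of them replaced by `f_1, …, f_k`. -/
def curveParameters (f : ℕ → R) (a : R) (e n N k : ℕ) (j : Fin (e + 1)) : R :=
  if j.1 = e then a ^ N + f e ^ n
  else if j.1 < k then f (j + 1) else f (j + 1) * a ^ n + f j ^ n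

variable {f : ℕ → R} {a : R} {e n N k : ℕ}

theorem curveParameters_last : curveParameters f a e n N k (Fin.last e) = a ^ N + f e ^ n :=
  if_pos rfl

theorem curveParameters_of_lt {j : ℕ} (hj : j < e) (hk : j < k) :
    curveParameters f a e n N k ⟨j, by omega⟩ = f (j + 1) := by
  rw [curveParameters, if_neg hj.ne, if_pos hk]

theorem curveParameters_of_ge {j : ℕ} (hj : j < e) (hk : k ≤ j) :
    curveParameters f a e n N k ⟨j, by omega⟩ = f (j + 1) * a ^ n + f j ^ n := by
  rw [curveParameters, if_neg hj.ne, if_neg hk.not_gt]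

theorem curveParameters_succ {j : Fin (e + 1)} (hj : j.1 ≠ k) :
    curveParameters f a e n N (k + 1) j = curveParameters f a e n N k j := by
  unfold curveParameters
  have : j.1 < k + 1 ↔ j.1 < k := by omega
  simp only [this]

theorem mem_span_curveParameters (h0 : f 0 = 0) {T : Finset (Fin (e + 1))} {i : ℕ} (hi : i ≤ k)
    (hie : i ≤ e) (hT : ∀ j : Fin (e + 1), j.1 < i → j ∈ T) :
    f i ∈ Ideal.span (curveParameters f a e n N k '' T) := by
  cases i with
  | zero => rw [h0]; exact zero_mem _
  | succ i =>
    refine Ideal.subset_span ⟨⟨i, by omega⟩, hT ⟨i, by omega⟩ (Nat.lt_succ_self i), ?_⟩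
    exact curveParameters_of_lt hie hi

/-- The error ideal `(a ^ n, f_j ^ n)` does not involve `N`. Multiplication by `f (k + 1)` sends it
into the `k`-th ideal: that ideal contains `f k`, hence `f (k + 1) * a ^ n`, and then the remaining
parameters yield the `f (k + 1) * f j ^ n`. -/
theorem length_quotient_curveParameters_le_add (h0 : f 0 = 0) (hn : n ≠ 0) (hN : n ≤ N)
    (hk : k < e) :
    Module.length R (R ⧸ Ideal.span (Set.range (curveParameters f a e n N k))) ≤
      Module.length R (R ⧸ Ideal.span (Set.range (curveParameters f a e n N (k + 1)))) +
      Module.length R (R ⧸ Ideal.span (insert (a ^ n) ((fun j => f j ^ n) '' Set.Iic e))) := by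
  have hmem : ∀ i ≤ k, f i ∈ Ideal.span (Set.range (curveParameters f a e n N k)) :=
    fun i hi => by
      have := mem_span_curveParameters (a := a) (e := e) (n := n) (N := N) h0 (T := Finset.univ) hi
        (by omega) fun _ _ => Finset.mem_univ _
      rwa [Finset.coe_univ, Set.image_univ] at this
  have hpar : ∀ j, curveParameters f a e n N k j ∈
    Ideal.span (Set.range (curveParameters f a e n N k)) := fun j => Ideal.subset_span ⟨j, rfl⟩
  have hfa : f (k + 1) * a ^ n ∈ Ideal.span (Set.range (curveParameters f a e n N k)) := by
    have h := hpar ⟨k, by omega⟩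
    rw [curveParameters_of_ge hk le_rfl] at h
    exact (Ideal.add_mem_iff_left _ (Ideal.pow_mem_of_mem _ (hmem k le_rfl) n hn.bot_lt)).1 h
  refine length_quotient_le_add (a := f (k + 1)) ?_ fun b hb => ?_
  · rw [Ideal.span_le]
    rintro _ ⟨j, rfl⟩
    by_cases hj : j.1 = k
    · obtain ⟨j, hj'⟩ := j
      subst hj
      rw [curveParameters_of_lt hk (Nat.lt_succ_self _)]
      exact Ideal.mem_sup_right (Ideal.mem_span_singleton_self _)
    · rw [curveParameters_succ hj]
      exact Ideal.mem_sup_left (hpar j)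
  · induction hb using Submodule.span_induction with
    | zero => rw [mul_zero]; exact zero_mem _
    | add b c _ _ hb hc => rw [mul_add]; exact add_mem hb hc
    | smul c b _ hb => rw [smul_eq_mul, mul_left_comm]; exact Ideal.mul_mem_left _ _ hb
    | mem b hb =>
      obtain rfl | ⟨j, hj, rfl⟩ := hb
      · exact hfa
      rcases le_or_gt j k with hjk | hjk
      · exact Ideal.mul_mem_left _ _ (Ideal.pow_mem_of_mem _ (hmem j hjk) n hn.bot_lt)
      rcases (Set.mem_Iic.1 hj).lt_or_eq with hje | rfl
      · have h := Ideal.mul_mem_left _ (f (k + 1)) (hpar ⟨j, by omega⟩)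
        rw [curveParameters_of_ge hje hjk.le, mul_add] at h
        refine (Ideal.add_mem_iff_right _ ?_).1 h
        rw [mul_left_comm]
        exact Ideal.mul_mem_left _ _ hfa
      · have h := Ideal.mul_mem_left _ (f (k + 1)) (hpar (Fin.last _))
        rw [curveParameters_last, mul_add] at h
        refine (Ideal.add_mem_iff_right _ ?_).1 h
        rw [← Nat.sub_add_cancel hN, pow_add, mul_comm (a ^ _), ← mul_assoc, Nat.sub_add_cancel hN]
        exact Ideal.mul_mem_right _ _ hfa

theorem length_quotient_curveParameters_le (h0 : f 0 = 0) (hn : n ≠ 0) (hN : n ≤ N) :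
    Module.length R (R ⧸ Ideal.span (Set.range (curveParameters f a e n N 0))) ≤
      N * Module.length R (R ⧸ Ideal.span (f '' Set.Iic e) ⊔ Ideal.span {a}) +
      e * Module.length R (R ⧸ Ideal.span (insert (a ^ n) ((fun j => f j ^ n) '' Set.Iic e))) := by
  have hstep : ∀ k ≤ e,
      Module.length R (R ⧸ Ideal.span (Set.range (curveParameters f a e n N 0))) ≤
      Module.length R (R ⧸ Ideal.span (Set.range (curveParameters f a e n N k))) +
      k * Module.length R
        (R ⧸ Ideal.span (insert (a ^ n) ((fun j => f j ^ n) '' Set.Iic e))) := fun k => by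
    induction k with
    | zero => simp
    | succ k ih =>
      intro hk
      refine (ih (by omega)).trans ?_
      rw [Nat.cast_add, Nat.cast_one, add_mul, one_mul, add_comm (_ * _), ← add_assoc]
      exact add_le_add_left (length_quotient_curveParameters_le_add h0 hn hN (by omega)) _
  refine (hstep e le_rfl).trans (add_le_add_left (le_trans (Submodule.length_quotient_anti ?_)
    (length_quotient_sup_span_pow_le _ a N)) _)
  have hmem : ∀ i ≤ e, f i ∈ Ideal.span (Set.range (curveParameters f a e n N e)) :=
    fun i hi => by
      have := mem_span_curveParameters (a := a) (e := e) (n := n) (N := N) h0 (T := Finset.univ) hi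
        hi fun _ _ => Finset.mem_univ _
      rwa [Finset.coe_univ, Set.image_univ] at this
  refine sup_le (Ideal.span_le.2 ?_) ((Ideal.span_singleton_le_iff_mem _).2 ?_)
  · rintro _ ⟨j, hj, rfl⟩
    exact hmem j hj
  · have h : curveParameters f a e n N e (Fin.last e) ∈
      Ideal.span (Set.range (curveParameters f a e n N e)) := Ideal.subset_span ⟨_, rfl⟩
    rw [curveParameters_last] at h
    exact (Ideal.add_mem_iff_left _ (Ideal.pow_mem_of_mem _ (hmem e le_rfl) n hn.bot_lt)).1 h

/-- If `a ∈ p`, the parameters reduce to powers of the `f j`. If not, `f 0 = 0` forces `f 1`, `f 2`,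
… into `p` in turn, and the last parameter then gives `a ∈ p`. -/
theorem mem_of_curveParameters_mem {p : Ideal R} (hp : p.IsPrime) (h0 : f 0 = 0) (hn : n ≠ 0)
    (hN : n ≤ N) (h : ∀ j, curveParameters f a e n N 0 j ∈ p) :
    (∀ j ≤ e, f j ∈ p) ∧ a ∈ p := by
  have hlast := h (Fin.last e)
  rw [curveParameters_last] at hlast
  by_cases ha : a ∈ p
  · refine ⟨fun j hj => hp.mem_of_pow_mem n ?_, ha⟩
    rcases hj.lt_or_eq with hj | rfl
    · have := h ⟨j, by omega⟩
      rw [curveParameters_of_ge hj (Nat.zero_le j)] at this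
      exact (Ideal.add_mem_iff_right _ (Ideal.mul_mem_left _ _
        (Ideal.pow_mem_of_mem _ ha n hn.bot_lt))).1 this
    · exact (Ideal.add_mem_iff_right _ (Ideal.pow_mem_of_mem _ ha N (by omega))).1 hlast
  · have hf : ∀ j ≤ e, f j ∈ p := fun j => by
      induction j with
      | zero => intro _; rw [h0]; exact zero_mem _
      | succ j ih =>
        intro hj
        have := h ⟨j, by omega⟩
        rw [curveParameters_of_ge hj (Nat.zero_le j)] at this
        have := (Ideal.add_mem_iff_left _
          (Ideal.pow_mem_of_mem _ (ih (by omega)) n hn.bot_lt)).1 this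
        exact (hp.mem_or_mem this).resolve_right fun h => ha (hp.mem_of_pow_mem n h)
    exact absurd (hp.mem_of_pow_mem N ((Ideal.add_mem_iff_left _
      (Ideal.pow_mem_of_mem _ (hf e le_rfl) n hn.bot_lt)).1 hlast)) ha

theorem curveParameters_mem_pow {I : Ideal R} (hf : ∀ j, f j ∈ I) (ha : a ∈ I) (hN : n ≤ N)
    (j : Fin (e + 1)) : curveParameters f a e n N 0 j ∈ I ^ n := by
  unfold curveParameters
  split_ifs with h1 h2
  · exact add_mem (Ideal.pow_le_pow_right hN (Ideal.pow_mem_pow ha N)) (Ideal.pow_mem_pow (hf e) n)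
  · exact absurd h2 (Nat.not_lt_zero _)
  · exact add_mem (Ideal.mul_mem_left _ _ (Ideal.pow_mem_pow ha n)) (Ideal.pow_mem_pow (hf _) n)

theorem isSystemOfParameters_curveParameters [IsNoetherianRing R] [IsLocalRing R]
    (hd : ringKrullDim R = (e + 1 : ℕ)) (h0 : f 0 = 0)
    (hf : ∀ j, f j ∈ IsLocalRing.maximalIdeal R) (ha : a ∈ IsLocalRing.maximalIdeal R)
    (h : ∀ p : PrimeSpectrum R, (∀ j ≤ e, f j ∈ p.asIdeal) → a ∈ p.asIdeal →
      p = IsLocalRing.closedPoint R) (hn : n ≠ 0) (hN : n ≤ N) :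
    IsSystemOfParameters R (curveParameters f a e n N 0) := by
  refine ⟨hd, le_antisymm ?_ ?_⟩
  · refine (IsLocalRing.maximalIdeal.isMaximal R).isPrime.radical_le_iff.2 (Ideal.span_le.2 ?_)
    rintro _ ⟨j, rfl⟩
    exact Ideal.pow_le_self hn (curveParameters_mem_pow hf ha hN j)
  · rw [Ideal.radical_eq_sInf]
    refine le_sInf fun p hp => ?_
    have hmem := mem_of_curveParameters_mem hp.2 h0 hn hN fun j => hp.1 (Ideal.subset_span ⟨j, rfl⟩)
    exact (congrArg PrimeSpectrum.asIdeal (h ⟨p, hp.2⟩ hmem.1 hmem.2)).ge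

/-- Passing to `f_1, …, f_e` one entry at a time does not increase the length; the last parameter
then acts as `a ^ N` on the cohomology of `f_1, …, f_e`. -/
theorem le_length_koszulCohomology_curveParameters [IsNoetherianRing R] [IsLocalRing R]
    {M : Type w} [AddCommGroup M] [Module R M] [Module.Finite R M] (h0 : f 0 = 0) (hn : n ≠ 0)
    (ha : a ∈ IsLocalRing.maximalIdeal R) {i : ℕ} {φ : Finset (Fin (e + 1)) → M}
    (hφ : φ ∈ subsetCocycles (fun j : Fin (e + 1) => f (j + 1)) M (Finset.univ.erase (Fin.last e)) i)
    (hφ' : ∀ m, a ^ m • φ ∉ subsetCoboundaries (fun j : Fin (e + 1) => f (j + 1)) M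
      (Finset.univ.erase (Fin.last e)) i) :
    (N : ℕ∞) ≤ Module.length R (KoszulCohomology (curveParameters f a e n N 0) M (i + 1)) := by
  refine le_trans ?_ length_subsetCohomology_univ_le
  have hstep : ∀ k ≤ e,
      Module.length R (SubsetCohomology (curveParameters f a e n N k) M Finset.univ (i + 1)) ≤
        Module.length R (SubsetCohomology (curveParameters f a e n N 0) M Finset.univ (i + 1)) :=
    fun k => by
      induction k with
      | zero => exact fun _ => le_rfl
      | succ k ih =>
        refine fun hk => le_trans ?_ (ih (by omega))
        let j : Fin (e + 1) := ⟨k, by omega⟩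
        have h := length_subsetCohomology_insert_le (M := M) (i := i)
          (x := curveParameters f a e n N k) (y := curveParameters f a e n N (k + 1))
          (T := Finset.univ.erase j) (j := j) (a := a ^ n) (c := f k ^ n) (Finset.notMem_erase _ _)
          (fun l hl => (curveParameters_succ fun h => Finset.ne_of_mem_erase hl (Fin.ext h)).symm)
          (Ideal.pow_mem_of_mem _ (mem_span_curveParameters h0 (Nat.le_succ k) (by omega)
            fun l hl => Finset.mem_erase.2 ⟨fun h => hl.ne (congrArg Fin.val h),
              Finset.mem_univ _⟩) n hn.bot_lt)
          (by
            rw [curveParameters_of_ge hk le_rfl, curveParameters_of_lt hk (Nat.lt_succ_self k),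
              mul_comm])
        rwa [Finset.insert_erase (Finset.mem_univ j)] at h
  refine le_trans ?_ (hstep e le_rfl)
  have hcongr : ∀ l ∈ Finset.univ.erase (Fin.last e),
      curveParameters f a e n N e l = f (l + 1) := fun l hl => by
    have hl : l.1 < e := by
      have h1 := l.2
      have h2 : l.1 ≠ e := fun h => Finset.ne_of_mem_erase hl (Fin.ext h)
      omega
    exact curveParameters_of_lt hl hl
  have h := le_length_subsetCohomology_insert (M := M) (i := i) (φ := φ) (n := N) (j := Fin.last e)
    (x := curveParameters f a e n N e) (T := Finset.univ.erase (Fin.last e))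
    (Finset.notMem_erase _ _) ha
    (Ideal.pow_mem_of_mem _ (mem_span_curveParameters h0 le_rfl le_rfl
      fun l hl => Finset.mem_erase.2 ⟨fun h => hl.ne (congrArg Fin.val h),
        Finset.mem_univ _⟩) n hn.bot_lt) curveParameters_last
    (by rwa [subsetCocycles_congr hcongr])
    fun m => by
      rw [subsetCoboundaries_congr hcongr]
      exact hφ' m
  rwa [Finset.insert_erase (Finset.mem_univ (Fin.last e))] at h

end Parameters

/-! ### Failure of effaceability, and torsion-freeness -/

section Main

theorem not_isEffaceable_of_subsetCocycle {R : Type u} [CommRing R] [IsNoetherianRing R]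
    [IsLocalRing R] {e : ℕ} (hd : ringKrullDim R = (e + 1 : ℕ)) {f : ℕ → R} {a : R}
    (h0 : f 0 = 0) (hf : ∀ j, f j ∈ IsLocalRing.maximalIdeal R)
    (ha : a ∈ IsLocalRing.maximalIdeal R)
    (h : ∀ p : PrimeSpectrum R, (∀ j ≤ e, f j ∈ p.asIdeal) → a ∈ p.asIdeal →
      p = IsLocalRing.closedPoint R)
    {M : Type w} [AddCommGroup M] [Module R M] [Module.Finite R M] {i : ℕ}
    {φ : Finset (Fin (e + 1)) → M}
    (hφ : φ ∈ subsetCocycles (fun j : Fin (e + 1) => f (j + 1)) M (Finset.univ.erase (Fin.last e)) i)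
    (hφ' : ∀ m, a ^ m • φ ∉ subsetCoboundaries (fun j : Fin (e + 1) => f (j + 1)) M
      (Finset.univ.erase (Fin.last e)) i) :
    ¬ IsEffaceable R M (i + 1) := by
  have hc : Module.length R (R ⧸ Ideal.span (f '' Set.Iic e) ⊔ Ideal.span {a}) ≠ ⊤ := by
    refine length_quotient_ne_top (sup_le (Ideal.span_le.2 ?_)
      ((Ideal.span_singleton_le_iff_mem _).2 ha)) fun p hp => h p (fun j hj => hp ?_) (hp ?_)
    · rintro _ ⟨j, -, rfl⟩
      exact hf j
    · exact Ideal.mem_sup_left (Ideal.subset_span ⟨j, hj, rfl⟩)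
    · exact Ideal.mem_sup_right (Ideal.mem_span_singleton_self a)
  obtain ⟨c, hc⟩ := ENat.ne_top_iff_exists.1 hc
  have hb : ∀ n, ∃ b : ℕ, (b : ℕ∞) = Module.length R
      (R ⧸ Ideal.span (insert (a ^ (n + 1)) ((fun j => f j ^ (n + 1)) '' Set.Iic e))) := fun n => by
    refine ENat.ne_top_iff_exists.1 (length_quotient_ne_top (Ideal.span_le.2 ?_)
      fun p hp => h p (fun j hj => ?_) ?_)
    · rintro _ (rfl | ⟨j, -, rfl⟩)
      · exact Ideal.pow_mem_of_mem _ ha _ n.succ_pos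
      · exact Ideal.pow_mem_of_mem _ (hf j) _ n.succ_pos
    · exact p.2.mem_of_pow_mem _ (hp (Ideal.subset_span (Or.inr ⟨j, hj, rfl⟩)))
    · exact p.2.mem_of_pow_mem _ (hp (Ideal.subset_span (Or.inl rfl)))
  choose b hb using hb
  intro heff
  -- The choice is possible because `b n` does not depend on `N`. It gives `N c + e b ≤ N (c + 1)`,
  -- and the summand `n + 1` keeps `N` at least the exponent.
  let N : ℕ → ℕ := fun n => n + 1 + e * b n
  have hN : ∀ n, n + 1 ≤ N n := fun n => Nat.le_add_right _ _
  have key := heff (e + 1) (fun n => curveParameters f a e (n + 1) (N n) 0)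
    (fun n => isSystemOfParameters_curveParameters hd h0 hf ha h n.succ_ne_zero (hN n))
    (fun n => Ideal.span_le.2 (by
      rintro _ ⟨j, rfl⟩
      exact Ideal.pow_le_pow_right (Nat.le_succ n) (curveParameters_mem_pow hf ha (hN n) j)))
  have hpos : (0 : ℝ≥0∞) < ((c + 1 : ℕ) : ℝ≥0∞)⁻¹ := ENNReal.inv_pos.2 (ENNReal.natCast_ne_top _)
  obtain ⟨n, hn⟩ := (key.eventually_lt_const hpos).exists
  refine absurd hn (not_lt.2 ?_)
  have h1 := le_length_koszulCohomology_curveParameters (M := M) (n := n + 1) (N := N n) h0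
    n.succ_ne_zero ha hφ hφ'
  have h2 : Module.length R
      (R ⧸ Ideal.span (Set.range (curveParameters f a e (n + 1) (N n) 0))) ≤
      ((N n * (c + 1) : ℕ) : ℕ∞) := by
    refine (length_quotient_curveParameters_le h0 n.succ_ne_zero (hN n)).trans ?_
    rw [← hc, ← hb n]
    norm_cast
    rw [mul_add, mul_one]
    exact Nat.add_le_add_left (Nat.le_add_left _ _) _
  have h1' : ((N n : ℕ) : ℝ≥0∞) ≤ ((Module.length R (KoszulCohomology
      (curveParameters f a e (n + 1) (N n) 0) M (i + 1)) : ℕ∞) : ℝ≥0∞) := by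
    exact_mod_cast ENat.toENNReal_le.2 h1
  have h2' : ((Module.length R
      (R ⧸ Ideal.span (Set.range (curveParameters f a e (n + 1) (N n) 0))) : ℕ∞) : ℝ≥0∞) ≤
      (N n : ℝ≥0∞) * ((c + 1 : ℕ) : ℝ≥0∞) := by
    refine (ENat.toENNReal_le.2 h2).trans ?_
    rw [ENat.toENNReal_coe]
    push_cast
    rfl
  refine le_trans ?_ (ENNReal.div_le_div h1' h2')
  have hN0 : (N n : ℝ≥0∞) ≠ 0 := by
    exact_mod_cast (show N n ≠ 0 by have := hN n; omega)
  rw [ENNReal.div_eq_inv_mul, ENNReal.mul_inv (Or.inl hN0) (Or.inl (ENNReal.natCast_ne_top _)),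
    mul_right_comm, ENNReal.inv_mul_cancel hN0 (ENNReal.natCast_ne_top _), one_mul]

/-- Over a Noetherian local ring of dimension `d`, a module with a nonmaximal associated prime of
coheight less than `d` fails to be `i`-effaceable for some `i < d`. -/
theorem exists_not_isEffaceable {R : Type u} [CommRing R] [IsNoetherianRing R] [IsLocalRing R]
    {d : ℕ} (hd : ringKrullDim R = d) {M : Type w} [AddCommGroup M] [Module R M]
    [Module.Finite R M] {P : PrimeSpectrum R} (hP : P.asIdeal ∈ associatedPrimes R M)
    (hPm : P ≠ IsLocalRing.closedPoint R) (hht : Order.coheight P < d) :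
    ∃ i < d, ¬ IsEffaceable R M i := by
  have hPlt : P < IsLocalRing.closedPoint R :=
    lt_of_le_of_ne (IsLocalRing.le_maximalIdeal P.2.ne_top) hPm
  have h1 : 1 ≤ Order.coheight P :=
    (self_le_add_left 1 _).trans (Order.coheight_add_one_le hPlt)
  obtain ⟨t, rfl⟩ : ∃ t, d = t + 2 := by
    have : 1 < d := by exact_mod_cast h1.trans_lt hht
    exact ⟨d - 2, by omega⟩
  -- A maximal element among the nonmaximal primes above `P` has only the maximal ideal strictly
  -- above it, hence coheight at most one.
  obtain ⟨Q, ⟨hPQ, hQm⟩, hQmax⟩ : ∃ Q ∈ {Q : PrimeSpectrum R | P ≤ Q ∧ Q ≠ IsLocalRing.closedPoint R},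
      ∀ p ∈ {Q : PrimeSpectrum R | P ≤ Q ∧ Q ≠ IsLocalRing.closedPoint R}, ¬ Q < p := by
    have hwf : WellFounded ((· > ·) : PrimeSpectrum R → PrimeSpectrum R → Prop) :=
      (InvImage.wf PrimeSpectrum.asIdeal (wellFounded_gt (α := Ideal R)))
    exact hwf.has_min {Q | P ≤ Q ∧ Q ≠ IsLocalRing.closedPoint R} ⟨P, le_rfl, hPm⟩
  have hQ : Order.coheight Q ≤ 1 := by
    refine Order.coheight_le_coe_iff (n := 1).2 fun p hp => ?_
    have hpm : p = IsLocalRing.closedPoint R := by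
      by_contra h
      exact hQmax p ⟨hPQ.trans hp.le, h⟩ hp
    have : Order.coheight p = 0 := by
      rw [Order.coheight_eq_zero, hpm]
      exact fun q _ => IsLocalRing.le_maximalIdeal q.2.ne_top
    rw [this]
    exact one_pos
  obtain ⟨f, a, hfQ, ham, haQ, hfa⟩ := exists_parameters_of_coheight_le_one (e := t + 1) hd.le hQ hQm
  -- Shift by one, since the recursive parameters start from a zeroth element equal to `0`.
  let g : ℕ → R := fun j => if j = 0 then 0 else f (j - 1)
  have hgQ : ∀ j, g j ∈ Q.asIdeal := fun j => by
    by_cases hj : j = 0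
    · simp [g, hj]
    · simpa [g, hj] using hfQ (j - 1)
  have ht : Order.coheight P ≤ t + 1 := by
    have : Order.coheight P < ((t + 1 : ℕ) : ℕ∞) + 1 := by exact_mod_cast hht
    exact_mod_cast Order.le_of_lt_add_one this
  obtain ⟨k, hk, φ, hφ, hφ'⟩ := exists_subsetCocycle_of_le_prime
    (T := Finset.univ.erase (Fin.last (t + 1))) (x := fun j : Fin (t + 1 + 1) => g (j + 1))
    hPQ hQm hP (fun j _ => hgQ _) ht
  refine ⟨k + 1, by omega, not_isEffaceable_of_subsetCocycle (e := t + 1) hd (f := g) (a := a)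
    (if_pos rfl) (fun j => IsLocalRing.le_maximalIdeal Q.2.ne_top (hgQ j)) ham
    (fun p hp hap => hfa p (fun j hj => ?_) hap) hφ
    fun m => hφ' _ fun hm => haQ (Q.2.mem_of_pow_mem m hm)⟩
  simpa [g] using hp (j + 1) (by omega)

theorem isTorsionFreeModule_quotient_of_isAsymptoticallyCM {R : Type u} [CommRing R]
    [IsNoetherianRing R] [IsLocalRing R] {d : ℕ} (hd : ringKrullDim R = d)
    (M : Type w) [AddCommGroup M] [Module R M] [Module.Finite R M]
    (hdim : Module.supportDim R M = d) (hM : IsAsymptoticallyCM R M) :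
    IsTorsionFreeModule R (M ⧸ zerothLocalCohomology R (IsLocalRing.maximalIdeal R) M) := by
  have heff : ∀ i < d, IsEffaceable R M i := by
    refine ((asyDepth_eq_coe_iff R M d).1 ?_).1
    unfold IsAsymptoticallyCM at hM
    rw [hdim] at hM
    exact_mod_cast hM
  intro a z hz
  obtain ⟨u, rfl⟩ := Submodule.Quotient.mk_surjective _ z
  by_contra! hcon
  obtain ⟨hu, ha⟩ := hcon
  rw [← Submodule.Quotient.mk_smul, Submodule.Quotient.mk_eq_zero] at hz
  rw [ne_eq, Submodule.Quotient.mk_eq_zero] at hu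
  obtain ⟨n, hn⟩ := hz
  -- If the maximal ideal were the only associated prime of `Ru`, a power of it would kill `u`.
  obtain ⟨P, hP, hPm⟩ : ∃ P ∈ associatedPrimes R (Submodule.span R {u}),
      P ≠ IsLocalRing.maximalIdeal R := by
    by_contra! h
    refine hu ?_
    have hle : IsLocalRing.maximalIdeal R ≤
        (Module.annihilator R (Submodule.span R {u})).radical := by
      rw [Ideal.radical_eq_sInf]
      refine le_sInf fun p hp => ?_
      have := hp.2
      obtain ⟨q, hq, hqp⟩ := Ideal.exists_minimalPrimes_le hp.1
      have := h q (Module.associatedPrimes.minimalPrimes_annihilator_subset_associatedPrimes R _ hq)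
      exact this ▸ hqp
    obtain ⟨n, hn⟩ := Ideal.exists_pow_le_of_le_radical_of_fg hle
      (IsNoetherian.noetherian (IsLocalRing.maximalIdeal R))
    refine ⟨n, fun b hb => ?_⟩
    have := Module.mem_annihilator.1 (hn hb) ⟨u, Submodule.mem_span_singleton_self u⟩
    exact congrArg Subtype.val this
  have hPM : P ∈ associatedPrimes R M :=
    associatedPrimes.subset_of_injective (f := (Submodule.span R {u}).subtype)
      (Submodule.injective_subtype _) hP
  have haP : a ∈ P := by
    -- As `m ^ n * a` annihilates `Ru`, it lies in `P`; since `P ≠ m`, this forces `a ∈ P`.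
    have hann : ∀ b ∈ IsLocalRing.maximalIdeal R ^ n, b * a ∈ P := fun b hb => by
      refine hP.annihilator_le (Module.mem_annihilator.2 ?_)
      rintro ⟨⟨v, hv⟩, -⟩
      obtain ⟨c, rfl⟩ := Submodule.mem_span_singleton.1 hv
      refine Subtype.ext (Subtype.ext ?_)
      change (b * a) • c • u = 0
      rw [smul_comm, mul_smul, hn b hb, smul_zero]
    by_contra haP
    refine hPm (le_antisymm (IsLocalRing.le_maximalIdeal hP.1.ne_top) fun b hb => ?_)
    exact hP.1.mem_of_pow_mem n
      ((hP.1.mem_or_mem (hann _ (Ideal.pow_mem_pow hb n))).resolve_right haP)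
  have := hP.1
  obtain ⟨q, hq, hqP⟩ := Ideal.exists_minimalPrimes_le (I := Module.annihilator R R) (J := P) (by rw [Module.annihilator_eq_bot.2 inferInstance]; exact bot_le)
  have haq : a ∉ q := ha q
    (Module.associatedPrimes.minimalPrimes_annihilator_subset_associatedPrimes R R hq)
  have hlt : (⟨q, hq.1.1⟩ : PrimeSpectrum R) < ⟨P, hP.1⟩ :=
    lt_of_le_of_ne hqP fun h => haq (by
      have h : q = P := congrArg PrimeSpectrum.asIdeal h
      exact h ▸ haP)
  have hht : Order.coheight (⟨P, hP.1⟩ : PrimeSpectrum R) < d := by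
    have h1 : Order.coheight (⟨q, hq.1.1⟩ : PrimeSpectrum R) ≤ d := by
      exact_mod_cast (Order.coheight_le_krullDim _).trans hd.le
    have h2 := (Order.coheight_add_one_le hlt).trans h1
    exact ENat.add_one_le_iff (fun h => by rw [h] at h2; simp at h2) |>.1 h2
  obtain ⟨i, hi, h⟩ := exists_not_isEffaceable hd (P := ⟨P, hP.1⟩) hPM
    (fun h => hPm (congrArg PrimeSpectrum.asIdeal h)) hht
  exact h (heff i hi)

end Main

/-! ### Dimension of the power series quotient -/

section PowerSeries

/-- Induction on `s`: subtracting the part of `h` free of `X i` leaves a multiple of `X i`, and the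
subtracted part is handled by the smaller set. -/
theorem MvPowerSeries.mem_span_range_X {σ V : Type*} [CommRing V] (s : Finset σ)
    {h : MvPowerSeries σ V}
    (hs : ∀ m : σ →₀ ℕ, (∀ i ∈ s, m i = 0) → MvPowerSeries.coeff m h = 0) :
    h ∈ Ideal.span (Set.range (MvPowerSeries.X : σ → MvPowerSeries σ V)) := by
  classical
  induction s using Finset.induction_on generalizing h with
  | empty =>
    have : h = 0 := MvPowerSeries.ext fun m => hs m (by simp)
    exact this ▸ zero_mem _
  | insert i s _ ih =>
    let g : MvPowerSeries σ V := fun m => if m i = 0 then MvPowerSeries.coeff m h else 0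
    have hg : ∀ m, MvPowerSeries.coeff m g = if m i = 0 then MvPowerSeries.coeff m h else 0 :=
      fun _ => rfl
    have h1 : g ∈ Ideal.span (Set.range (MvPowerSeries.X : σ → MvPowerSeries σ V)) := by
      refine ih fun m hm => ?_
      rw [hg]
      split_ifs with hi
      · exact hs m fun j hj => (Finset.mem_insert.1 hj).elim (fun h => h ▸ hi) (hm j)
      · rfl
    have h2 : MvPowerSeries.X i ∣ h - g := MvPowerSeries.X_dvd_iff.2 fun m hm => by
      rw [map_sub, hg, if_pos hm, sub_self]
    rw [← sub_add_cancel h g]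
    exact add_mem (Ideal.mem_of_dvd _ h2 (Ideal.subset_span ⟨i, rfl⟩)) h1

theorem MvPowerSeries.maximalIdeal_le_span {σ V : Type*} [Finite σ] [CommRing V] [IsLocalRing V]
    {p : V} (hp : IsLocalRing.maximalIdeal V = Ideal.span {p}) :
    IsLocalRing.maximalIdeal (MvPowerSeries σ V) ≤
      Ideal.span (insert (MvPowerSeries.C p) (Set.range MvPowerSeries.X)) := by
  have := Fintype.ofFinite σ
  intro g hg
  have hc : MvPowerSeries.constantCoeff g ∈ Ideal.span {p} := by
    rw [← hp]
    exact fun h => hg (MvPowerSeries.isUnit_iff_constantCoeff.2 h)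
  obtain ⟨c, hc⟩ := Ideal.mem_span_singleton'.1 hc
  rw [← sub_add_cancel g (MvPowerSeries.C (MvPowerSeries.constantCoeff g)), ← hc, map_mul]
  refine add_mem (Ideal.span_mono (Set.subset_insert _ _) ?_)
    (Ideal.mul_mem_left _ _ (Ideal.subset_span (Set.mem_insert _ _)))
  refine MvPowerSeries.mem_span_range_X Finset.univ fun m hm => ?_
  have hm0 : m = 0 := Finsupp.ext fun i => hm i (Finset.mem_univ i)
  rw [hm0, ← map_mul, hc, MvPowerSeries.coeff_zero_eq_constantCoeff_apply, map_sub,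
    MvPowerSeries.constantCoeff_C, sub_self]

/-- The maximal ideal of `R ⧸ q` is generated by the `d` images of the `g j`, which bounds its
dimension. -/
theorem coheight_le_of_maximalIdeal_le_sup {R : Type*} [CommRing R] [IsNoetherianRing R]
    [IsLocalRing R] {d : ℕ} (q : PrimeSpectrum R) {g : Fin d → R}
    (hg : ∀ j, g j ∈ IsLocalRing.maximalIdeal R)
    (h : IsLocalRing.maximalIdeal R ≤ q.asIdeal ⊔ Ideal.span (Set.range g)) :
    Order.coheight q ≤ d := by
  have : Nontrivial (R ⧸ q.asIdeal) := Ideal.Quotient.nontrivial_iff.2 q.2.ne_top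
  have : IsLocalRing (R ⧸ q.asIdeal) :=
    IsLocalRing.of_surjective' (Ideal.Quotient.mk q.asIdeal) Ideal.Quotient.mk_surjective
  have := IsLocalHom.of_surjective (Ideal.Quotient.mk q.asIdeal) Ideal.Quotient.mk_surjective
  have hspan : IsLocalRing.maximalIdeal (R ⧸ q.asIdeal) =
      Ideal.span (Set.range fun j => Ideal.Quotient.mk q.asIdeal (g j)) := by
    apply le_antisymm
    · intro z hz
      obtain ⟨b, rfl⟩ := Ideal.Quotient.mk_surjective z
      have hb : b ∈ IsLocalRing.maximalIdeal R := fun hb => hz (hb.map _)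
      obtain ⟨c, hc, c', hc', rfl⟩ := Submodule.mem_sup.1 (h hb)
      rw [map_add, Ideal.Quotient.eq_zero_iff_mem.2 hc, zero_add]
      have := Ideal.mem_map_of_mem (Ideal.Quotient.mk q.asIdeal) hc'
      rwa [Ideal.map_span, ← Set.range_comp] at this
    · rw [Ideal.span_le]
      rintro _ ⟨j, rfl⟩
      exact fun hj => hg j (isUnit_of_map_unit _ _ hj)
  have hdim : ringKrullDim (R ⧸ q.asIdeal) ≤ d := by
    refine (ringKrullDim_le_spanFinrank_maximalIdeal _).trans ?_
    rw [hspan]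
    have h1 := Submodule.spanFinrank_span_le_ncard_of_finite (R := R ⧸ q.asIdeal)
      (Set.finite_range fun j => Ideal.Quotient.mk q.asIdeal (g j))
    have h2 : (Set.range fun j => Ideal.Quotient.mk q.asIdeal (g j)).ncard ≤ d := by
      rw [← Set.image_univ]
      exact (Set.ncard_image_le Set.finite_univ).trans (by simp)
    exact_mod_cast h1.trans h2
  have hIci : PrimeSpectrum.zeroLocus (q.asIdeal : Set R) = Set.Ici q := rfl
  rw [ringKrullDim_quotient, hIci, ← Order.coheight_eq_krullDim_Ici] at hdim
  exact_mod_cast hdim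

/-- The maximal ideal is generated by the `d + 1` elements $p, x_1, \dots, x_d$. As $p^s x_1 = 0$,
every prime contains $p$ or $x_1$, so modulo any prime `d` generators suffice. -/
theorem IsPowerSeriesModMonomial.ringKrullDim_le {R : Type u} [CommRing R] [IsNoetherianRing R]
    [IsLocalRing R] {d : ℕ} (hR : IsPowerSeriesModMonomial.{u, v} R d) : ringKrullDim R ≤ d := by
  obtain ⟨V, _, _, _, _, p, s, hd, hp, -, ⟨e⟩⟩ := hR
  let π : MvPowerSeries (Fin d) V →+* R := e.symm.toRingHom.comp (Ideal.Quotient.mk _)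
  have hπ : Function.Surjective π := e.symm.surjective.comp Ideal.Quotient.mk_surjective
  have := IsLocalHom.of_surjective π hπ
  have hzero : π (MvPowerSeries.C p) ^ s * π (MvPowerSeries.X ⟨0, hd⟩) = 0 := by
    rw [← map_pow, ← map_mul]
    change e.symm _ = 0
    rw [Ideal.Quotient.eq_zero_iff_mem.2 (Ideal.mem_span_singleton_self _), map_zero]
  have hC : π (MvPowerSeries.C p) ∈ IsLocalRing.maximalIdeal R := fun h => by
    have h := MvPowerSeries.isUnit_iff_constantCoeff.1 (isUnit_of_map_unit _ _ h)
    rw [MvPowerSeries.constantCoeff_C] at h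
    have hpm : p ∈ IsLocalRing.maximalIdeal V := hp ▸ Ideal.mem_span_singleton_self p
    exact hpm h
  have hX : ∀ j, π (MvPowerSeries.X j) ∈ IsLocalRing.maximalIdeal R := fun j h => by
    have h := MvPowerSeries.isUnit_iff_constantCoeff.1 (isUnit_of_map_unit _ _ h)
    rw [MvPowerSeries.constantCoeff_X] at h
    exact not_isUnit_zero h
  have hm : IsLocalRing.maximalIdeal R ≤ Ideal.span
      (insert (π (MvPowerSeries.C p)) (Set.range fun j => π (MvPowerSeries.X j))) := by
    intro b hb
    obtain ⟨b, rfl⟩ := hπ b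
    have h := Ideal.mem_map_of_mem π
      (MvPowerSeries.maximalIdeal_le_span hp (show b ∈ IsLocalRing.maximalIdeal _ from
        fun h => hb (h.map _)))
    rwa [Ideal.map_span, Set.image_insert_eq, ← Set.range_comp] at h
  have key : ∀ q : PrimeSpectrum R, Order.coheight q ≤ d := fun q => by
    rcases q.2.mem_or_mem (hzero ▸ zero_mem q.asIdeal) with h | h
    · refine coheight_le_of_maximalIdeal_le_sup q hX (hm.trans (Ideal.span_le.2 ?_))
      rintro _ (rfl | ⟨j, rfl⟩)
      · exact Ideal.mem_sup_left (q.2.mem_of_pow_mem _ h)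
      · exact Ideal.mem_sup_right (Ideal.subset_span ⟨j, rfl⟩)
    · refine coheight_le_of_maximalIdeal_le_sup q (g := Function.update
        (fun j => π (MvPowerSeries.X j)) ⟨0, hd⟩ (π (MvPowerSeries.C p))) (fun j => ?_)
        (hm.trans (Ideal.span_le.2 ?_))
      · by_cases hj : j = ⟨0, hd⟩
        · rw [hj, Function.update_self]
          exact hC
        · rw [Function.update_of_ne hj]
          exact hX j
      · rintro _ (rfl | ⟨j, rfl⟩)
        · exact Ideal.mem_sup_right (Ideal.subset_span ⟨⟨0, hd⟩, Function.update_self _ _ _⟩)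
        · by_cases hj : j = ⟨0, hd⟩
          · subst hj
            exact Ideal.mem_sup_left h
          · exact Ideal.mem_sup_right (Ideal.subset_span ⟨j, Function.update_of_ne hj _ _⟩)
  rw [ringKrullDim, Order.krullDim_eq_iSup_coheight]
  exact iSup_le fun q => by exact_mod_cast key q

end PowerSeries

theorem mainTheorem8 {R : Type u} [CommRing R] [IsLocalRing R] [IsNoetherianRing R]
    (d : ℕ) (hd : 2 ≤ d)
    (hR : (IsRegularLocalRing R ∧ IsAdicComplete (IsLocalRing.maximalIdeal R) R ∧
        ringKrullDim R = d) ∨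
      IsPowerSeriesModMonomial.{u, v} R d)
    (M : Type w) [AddCommGroup M] [Module R M] [Module.Finite R M]
    (hdim : Module.supportDim R M = d)
    (hM : IsAsymptoticallyCM R M) :
    IsTorsionFreeModule R (M ⧸ zerothLocalCohomology R (IsLocalRing.maximalIdeal R) M) := by
  have hRd : ringKrullDim R = d := by
    rcases hR with ⟨-, -, h⟩ | h
    · exact h
    -- The lower bound on the dimension of `R` comes from the module: `d = dim M ≤ dim R`.
    · exact le_antisymm h.ringKrullDim_le (hdim ▸ Module.supportDim_le_ringKrullDim R M)
  exact isTorsionFreeModule_quotient_of_isAsymptoticallyCM hRd M hdim hM
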